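/- Let $F$ be a field whose characteristic is either $0$ or a prime $p\geq 7$. Permutations are composed from left to right. Let $\mathscr{D}_6(F)$ be the descent algebra of the symmetric group $S_6$: the subalgebra of $FS_6$ spanned by the elements $\Xi^q$, one for each composition $q$ of $6$, where $\Xi^q$ is the sum of the minimal length right coset representatives of the Young subgroup $S_q$ in $S_6$. For each partition $\lambda$ of $6$ let $M_\lambda$ be the one-dimensional $\mathscr{D}_6(F)$-module on which $\Xi^q$ acts as multiplication by (the image in $F$ of) the number of right cosets of $S_q$ in $S_6$ fixed by a permutation of cycle type $\lambda$. Let $Q_{6,p}$ be the Ext quiver of $\mathscr{D}_6(F)$: its vertices are the partitions of $6$ (all of them are $p$-regular), and the number of arrows $\lambda\to\mu$ is $\dim_F\operatorname{Ext}^1_{\mathscr{D}_6(F)}(M_\lambda,M_\mu)$. Paths are composed from right to left in the path algebra $FQ_{6,p}$, and $e_\lambda$ denotes the path of length zero at the vertex $\lambda$. Then there is an isomorphism of $F$-algebras $\mathscr{D}_6(F)\cong FQ_{6,p}/I$, where $I$ is a two-sided ideal of $FQ_{6,p}$ which is one-dimensional over $F$, spanned by a nonzero linear combination $\omega$ of paths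 of length at least $2$ satisfying $\omega=e_{6}\,\omega\, e_{2^21^2}$; that is, $\omega$ is a relation from the vertex $2^21^2$ to the vertex $6$. Under the isomorphism, the image of $e_\lambda$ in $FQ_{6,p}/I$ corresponds to an idempotent of $\mathscr{D}_6(F)$ acting as $1$ on $M_\lambda$ and as $0$ on $M_\mu$ for every $\mu\neq\lambda$. -/

import Mathlib

noncomputable section

namespace DescentAlg

open Equiv Finset
open scoped Classical

/-! ### Minimal coset representatives and the elements `Ξ^q` -/

/-- The Young subgroup of a composition `q` of `n`: the permutations preserving each of the
consecutive blocks of sizes `q₁, q₂, …` (`q.index i` is the number of the block containing `i`). -/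
def youngSubgroup {n : ℕ} (q : Composition n) : Subgroup (Perm (Fin n)) where
  carrier := {h | ∀ i, q.index (h i) = q.index i}
  mul_mem' := fun {a b} ha hb i => (ha (b i)).trans (hb i)
  one_mem' := by intro i; rfl
  inv_mem' := by
    intro a ha i
    exact (ha (a⁻¹ i)).symm.trans (congrArg q.index (a.apply_symm_apply i))

/-- The number of inversions of a permutation, i.e. its Coxeter length. -/
def inversionNumber {n : ℕ} (σ : Perm (Fin n)) : ℕ :=
  #{ij : Fin n × Fin n | ij.1 < ij.2 ∧ σ ij.2 < σ ij.1}

/-- `σ` has minimal length in its right coset of the Young subgroup. Permutations are composed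
from left to right in this theory, so in terms of Lean's product (right to left) the right
coset of `σ` consists of the `σ * h` with `h` in the Young subgroup. -/
def IsMinimalCosetRep {n : ℕ} (q : Composition n) (σ : Perm (Fin n)) : Prop :=
  ∀ h ∈ youngSubgroup q, inversionNumber σ ≤ inversionNumber (σ * h)

/-- The group algebra of the symmetric group `S_n`, where permutations are composed from left to
right: this is the group algebra of the opposite of Lean's group `Perm (Fin n)`. -/
abbrev SymGroupAlgebra (F : Type*) [CommRing F] (n : ℕ) : Type _ :=
  MonoidAlgebra F (Perm (Fin n))ᵐᵒᵖ

/-- A permutation as an element of the group algebra. -/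
def ofPerm (F : Type*) [CommRing F] {n : ℕ} (σ : Perm (Fin n)) : SymGroupAlgebra F n :=
  MonoidAlgebra.of F _ (MulOpposite.op σ)

/-- `Ξ^q`: the sum of the minimal length right coset representatives of the Young subgroup. -/
def Xi (F : Type*) [CommRing F] {n : ℕ} (q : Composition n) : SymGroupAlgebra F n :=
  ∑ σ : Perm (Fin n) with IsMinimalCosetRep q σ, ofPerm F σ

/-- The Young character `φ^q` at `σ`: the number of right cosets of the Young subgroup that are
fixed by `σ`. (With composition from left to right, right cosets are Lean's left cosets.) -/
def youngCharacter {n : ℕ} (q : Composition n) (σ : Perm (Fin n)) : ℕ :=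
  Nat.card (MulAction.fixedBy (Perm (Fin n) ⧸ youngSubgroup q) σ)

/-! ### Auxiliary facts: closure of the span under multiplication -/

/-- The permutations increasing on the level sets of `b`. -/
def incr {n : ℕ} {α : Type*} (b : Fin n → α) : Finset (Perm (Fin n)) :=
  {σ | ∀ i j, i < j → b i = b j → σ i < σ j}

/-- The rearrangements of a word. -/
def rearr {n : ℕ} {α : Type*} [Fintype α] [LinearOrder α] (b : Fin n → α) :
    Finset (Fin n → α) :=
  {f | f ∘ Tuple.sort f = b}

theorem perm_inv_apply {n : ℕ} (σ : Perm (Fin n)) (i : Fin n) : σ⁻¹ (σ i) = i :=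
  σ.symm_apply_apply i

theorem perm_apply_inv {n : ℕ} (σ : Perm (Fin n)) (i : Fin n) : σ (σ⁻¹ i) = i :=
  σ.apply_symm_apply i

theorem mem_incr {n : ℕ} {α : Type*} {b : Fin n → α} {σ : Perm (Fin n)} :
    σ ∈ incr b ↔ ∀ i j, i < j → b i = b j → σ i < σ j := by
  simp [incr]

theorem mem_rearr {n : ℕ} {α : Type*} [Fintype α] [LinearOrder α] {b f : Fin n → α} :
    f ∈ rearr b ↔ f ∘ Tuple.sort f = b := by
  simp [rearr]

theorem rearr_comp {n : ℕ} {α : Type*} [Fintype α] [LinearOrder α] {b f : Fin n → α}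
    (σ : Perm (Fin n)) : f ∘ σ ∈ rearr b ↔ f ∈ rearr b := by
  rw [mem_rearr, mem_rearr, Tuple.comp_perm_comp_sort_eq_comp_sort]

theorem sort_of_incr {n : ℕ} {α : Type*} [LinearOrder α] {b : Fin n → α}
    (hb : Monotone b) {σ : Perm (Fin n)} (hσ : σ ∈ incr b) : Tuple.sort (b ∘ ⇑σ⁻¹) = σ := by
  symm
  rw [Tuple.eq_sort_iff]
  have h : (b ∘ ⇑σ⁻¹) ∘ σ = b := by ext i; simp
  refine ⟨by rw [h]; exact hb, fun i j hij hf => ?_⟩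
  simp only [Function.comp_apply, perm_inv_apply] at hf
  exact mem_incr.1 hσ i j hij hf

theorem sum_incr {n : ℕ} {α : Type*} [Fintype α] [LinearOrder α] {b : Fin n → α}
    (hb : Monotone b) {M : Type*} [AddCommMonoid M] (G : Perm (Fin n) → M) :
    ∑ σ ∈ incr b, G σ = ∑ f ∈ rearr b, G (Tuple.sort f) := by
  refine Finset.sum_bij' (fun σ _ => b ∘ ⇑σ⁻¹) (fun f _ => Tuple.sort f) ?_ ?_ ?_ ?_ ?_
  · intro σ hσ
    rw [mem_rearr, sort_of_incr hb hσ]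
    ext i; simp
  · intro f hf
    rw [mem_rearr] at hf
    rw [mem_incr]
    intro i j hij h
    rw [← hf] at h
    exact (Tuple.eq_sort_iff.1 rfl).2 i j hij h
  · intro σ hσ
    exact sort_of_incr hb hσ
  · intro f hf
    rw [mem_rearr] at hf
    rw [← hf]
    ext i; simp
  · intro σ hσ
    rw [sort_of_incr hb hσ]

/-- The word of pairs formed from two words. -/
def pairWord {n : ℕ} {α β : Type*} (f : Fin n → α) (g : Fin n → β) : Fin n → α ×ₗ β :=
  fun i => toLex (f i, g i)

theorem sort_mul_sort {n : ℕ} {α β : Type*} [LinearOrder α] [LinearOrder β]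
    (f : Fin n → α) (g : Fin n → β) :
    Tuple.sort g * Tuple.sort f = Tuple.sort (pairWord (f ∘ ⇑(Tuple.sort g)⁻¹) g) := by
  rw [Tuple.eq_sort_iff]
  have hf := (Tuple.eq_sort_iff (f := f)).1 rfl
  have hg := (Tuple.eq_sort_iff (f := g)).1 rfl
  constructor
  · intro i j hij
    rcases hij.eq_or_lt with rfl | hij'
    · exact le_rfl
    simp only [pairWord, Function.comp_apply, Perm.mul_apply, perm_inv_apply]
    rw [Prod.Lex.toLex_le_toLex]
    rcases (hf.1 hij).lt_or_eq with h | h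
    · exact Or.inl h
    · exact Or.inr ⟨h, hg.1 (hf.2 i j hij' h).le⟩
  · intro i j hij h
    simp only [pairWord, Perm.mul_apply, Function.comp_apply, perm_inv_apply,
      toLex_inj, Prod.mk.injEq] at h
    exact hg.2 _ _ (hf.2 i j hij h.1) h.2

/-- The sorted words of pairs whose components are rearrangements of `b` and `b'`. -/
def pairSorted {n : ℕ} {α β : Type*} [Fintype α] [LinearOrder α] [Fintype β] [LinearOrder β]
    (b : Fin n → α) (b' : Fin n → β) : Finset (Fin n → α ×ₗ β) :=
  {m | Monotone m ∧ (fun i => (ofLex (m i)).1) ∈ rearr b ∧ (fun i => (ofLex (m i)).2) ∈ rearr b'}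

theorem sum_pairWord {n : ℕ} {α β : Type*} [Fintype α] [LinearOrder α] [Fintype β]
    [LinearOrder β] (b : Fin n → α) (b' : Fin n → β) {M : Type*} [AddCommMonoid M]
    (G : (Fin n → α ×ₗ β) → M) :
    ∑ f ∈ rearr b, ∑ g ∈ rearr b', G (pairWord f g) =
      ∑ m ∈ pairSorted b b', ∑ h ∈ rearr m, G h := by
  have h1 : ∑ f ∈ rearr b, ∑ g ∈ rearr b', G (pairWord f g) =
      ∑ h : Fin n → α ×ₗ β with (fun i => (ofLex (h i)).1) ∈ rearr b ∧
        (fun i => (ofLex (h i)).2) ∈ rearr b', G h := by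
    rw [← Finset.sum_product']
    refine Finset.sum_bij' (fun p _ => pairWord p.1 p.2)
      (fun h _ => (fun i => (ofLex (h i)).1, fun i => (ofLex (h i)).2)) ?_ ?_ ?_ ?_ ?_
    · intro p hp
      simpa [pairWord] using hp
    · intro h hh
      simpa using hh
    · intro p hp
      rfl
    · intro h hh
      rfl
    · intro p hp
      rfl
  rw [h1, ← Finset.sum_fiberwise_of_maps_to (t := pairSorted b b')
    (g := fun h => h ∘ Tuple.sort h)]
  · refine Finset.sum_congr rfl fun m hm => Finset.sum_congr ?_ fun _ _ => rfl
    ext h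
    simp only [Finset.mem_filter, Finset.mem_univ, true_and, mem_rearr (b := m)]
    refine ⟨fun h' => h'.2, fun h' => ⟨?_, h'⟩⟩
    simp only [pairSorted, Finset.mem_filter, Finset.mem_univ, true_and] at hm
    subst h'
    exact ⟨(rearr_comp (Tuple.sort h)).1 hm.2.1, (rearr_comp (Tuple.sort h)).1 hm.2.2⟩
  · intro h hh
    simp only [Finset.mem_filter, Finset.mem_univ, true_and] at hh
    simp only [pairSorted, Finset.mem_filter, Finset.mem_univ, true_and]
    exact ⟨Tuple.monotone_sort h, (rearr_comp (Tuple.sort h)).2 hh.1,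
      (rearr_comp (Tuple.sort h)).2 hh.2⟩

theorem index_mono {n : ℕ} (q : Composition n) : Monotone q.index := by
  intro i j hij
  by_contra h
  rw [not_le] at h
  have h1 := q.lt_sizeUpTo_index_succ j
  have h2 := q.sizeUpTo_index_le i
  have h3 : q.sizeUpTo (q.index j).succ ≤ q.sizeUpTo (q.index i) :=
    q.monotone_sizeUpTo (by simpa using Nat.succ_le_of_lt h)
  have h4 : (i : ℕ) ≤ j := hij
  omega

theorem mem_youngSubgroup {n : ℕ} {q : Composition n} {h : Perm (Fin n)} :
    h ∈ youngSubgroup q ↔ ∀ i, q.index (h i) = q.index i := Iff.rfl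

theorem inversionNumber_swap_lt {n : ℕ} (σ : Perm (Fin n)) (k l : Fin n)
    (hkl : (k : ℕ) + 1 = l) (hσ : σ l < σ k) :
    inversionNumber (σ * swap k l) < inversionNumber σ := by
  have hk : k < l := by rw [Fin.lt_def]; omega
  unfold inversionNumber
  rw [← Finset.card_map ((swap k l).prodCongr (swap k l)).toEmbedding]
  apply Finset.card_lt_card
  rw [Finset.ssubset_iff_of_subset]
  · refine ⟨(k, l), by simp [hk, hσ], ?_⟩
    simp only [Finset.mem_map_equiv, Finset.mem_filter, not_and]
    intro _ h
    simp [hk.not_gt] at h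
  · intro x hx
    obtain ⟨a, b⟩ := x
    rw [Finset.mem_map_equiv, Finset.mem_filter] at hx
    rw [Finset.mem_filter]
    replace hx := hx.2
    simp only [Equiv.prodCongr_symm, symm_swap, prodCongr_apply, Prod.map_apply, Perm.mul_apply,
      swap_apply_self] at hx
    refine ⟨Finset.mem_univ _, ?_⟩
    obtain ⟨h1, h2⟩ := hx
    refine ⟨?_, h2⟩
    by_contra hab
    simp only [swap_apply_def] at h1
    have hne : (a : ℕ) ≠ b := fun e => by
      rw [Fin.ext e] at h2
      exact lt_irrefl _ h2
    have hne' : ¬ (a = l ∧ b = k) := by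
      rintro ⟨rfl, rfl⟩
      exact lt_asymm h2 hσ
    simp only [Fin.ext_iff] at hne'
    split_ifs at h1 <;> simp only [Fin.ext_iff, Fin.lt_def] at * <;> omega

theorem incr_of_isMinimalCosetRep {n : ℕ} {q : Composition n} {σ : Perm (Fin n)}
    (h : IsMinimalCosetRep q σ) : σ ∈ incr q.index := by
  have key : ∀ k l : Fin n, (k : ℕ) + 1 = l → q.index k = q.index l → σ k < σ l := by
    intro k l hkl hq
    by_contra hc
    have hne : σ k ≠ σ l := fun h => by
      have := σ.injective h
      rw [this] at hkl
      omega
    refine absurd (h (swap k l) ?_) (not_le.2 (inversionNumber_swap_lt σ k l hkl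
      (lt_of_le_of_ne (not_lt.1 hc) hne.symm)))
    intro i
    rw [swap_apply_def]
    split_ifs with h1 h2
    · rw [h1, hq]
    · rw [h2, hq]
    · rfl
  rw [mem_incr]
  have main : ∀ d : ℕ, ∀ i j : Fin n, (i : ℕ) + (d + 1) = j → q.index i = q.index j →
      σ i < σ j := by
    intro d
    induction d with
    | zero => exact fun i j hij hq => key i j hij hq
    | succ d ih =>
      intro i j hij hq
      have hm : (i : ℕ) + (d + 1) < n := by omega
      have h1 : q.index i ≤ q.index ⟨i + (d + 1), hm⟩ :=
        index_mono q (by rw [Fin.le_def]; simp)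
      have h2 : q.index ⟨i + (d + 1), hm⟩ ≤ q.index j :=
        index_mono q (by rw [Fin.le_def]; simp; omega)
      have h3 : q.index i = q.index ⟨i + (d + 1), hm⟩ := le_antisymm h1 (h2.trans hq.ge)
      exact (ih i _ rfl h3).trans (key _ j (by simp; omega) (h3.symm.trans hq))
  intro i j hij hq
  have hij' : (i : ℕ) < j := hij
  exact main (j - i - 1) i j (by omega) hq

theorem isMinimalCosetRep_iff {n : ℕ} {q : Composition n} {σ : Perm (Fin n)} :
    IsMinimalCosetRep q σ ↔ σ ∈ incr q.index := by
  refine ⟨incr_of_isMinimalCosetRep, fun h => ?_⟩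
  obtain ⟨h₀, hh, hmin⟩ := (Set.toFinite (youngSubgroup q : Set (Perm (Fin n)))).exists_minimalFor
    (fun h => inversionNumber (σ * h)) _ ⟨1, (youngSubgroup q).one_mem⟩
  have hmin' : ∀ k ∈ youngSubgroup q, inversionNumber (σ * h₀) ≤ inversionNumber (σ * k) := by
    intro k hk
    by_contra hc
    exact hc (hmin hk (not_le.1 hc).le)
  have h1 : IsMinimalCosetRep q (σ * h₀) := by
    intro k hk
    rw [mul_assoc]
    exact hmin' _ ((youngSubgroup q).mul_mem hh hk)
  have h2 := sort_of_incr (index_mono q) (incr_of_isMinimalCosetRep h1)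
  have h3 : q.index ∘ ⇑(σ * h₀)⁻¹ = q.index ∘ ⇑σ⁻¹ := by
    ext i
    simp only [mul_inv_rev, Function.comp_apply, Perm.mul_apply]
    exact congrArg Fin.val (((youngSubgroup q).inv_mem hh) (σ⁻¹ i))
  rw [h3, sort_of_incr (index_mono q) h] at h2
  rw [h2]
  exact h1

theorem incr_congr {n : ℕ} {α β : Type*} {b : Fin n → α} {b' : Fin n → β}
    (h : ∀ i j, b i = b j ↔ b' i = b' j) : incr b = incr b' := by
  ext σ
  simp only [mem_incr, h]

theorem Xi_eq_sum_incr (F : Type*) [CommRing F] {n : ℕ} (q : Composition n) :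
    Xi F q = ∑ σ ∈ incr q.index, ofPerm F σ := by
  unfold Xi
  refine Finset.sum_congr ?_ fun _ _ => rfl
  ext σ
  simp [isMinimalCosetRep_iff]

theorem Xi_eq_sum_rearr (F : Type*) [CommRing F] {n : ℕ} {α : Type*} [Fintype α] [LinearOrder α]
    (q : Composition n) {b : Fin n → α} (hb : Monotone b)
    (h : ∀ i j, q.index i = q.index j ↔ b i = b j) :
    Xi F q = ∑ f ∈ rearr b, ofPerm F (Tuple.sort f) := by
  rw [Xi_eq_sum_incr, incr_congr h, sum_incr hb]

theorem youngCharacter_eq {n : ℕ} {α : Type*} [Fintype α] [LinearOrder α]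
    (q : Composition n) {b : Fin n → α} (hb : Monotone b)
    (h : ∀ i j, q.index i = q.index j ↔ b i = b j) (σ : Perm (Fin n)) :
    youngCharacter q σ = ∑ f ∈ rearr b, if f ∘ σ = f then 1 else 0 := by
  have hY : ∀ g : Perm (Fin n), g ∈ youngSubgroup q ↔ ∀ i, b (g i) = b i := by
    intro g
    simp only [mem_youngSubgroup, h]
  rw [← Finset.card_filter, ← Fintype.card_coe, ← Nat.card_eq_fintype_card]
  have hinj : ∀ g g' : Perm (Fin n), b ∘ ⇑g⁻¹ = b ∘ ⇑g'⁻¹ ↔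
      (g : Perm (Fin n) ⧸ youngSubgroup q) = g' := by
    intro g g'
    rw [QuotientGroup.eq, hY]
    constructor
    · intro e i
      have := congrFun e (g' i)
      simpa [perm_inv_apply] using this
    · intro e
      ext i
      have := e (g'⁻¹ i)
      rw [Perm.mul_apply, perm_apply_inv] at this
      exact this
  let Φ : (Perm (Fin n) ⧸ youngSubgroup q) → (Fin n → α) :=
    Quotient.lift (fun g : Perm (Fin n) => b ∘ ⇑g⁻¹)
      (fun g g' e => (hinj g g').2 (Quotient.sound e))
  have hΦ : ∀ g : Perm (Fin n), Φ (g : Perm (Fin n) ⧸ youngSubgroup q) = b ∘ ⇑g⁻¹ := fun _ => rfl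
  have hmem : ∀ x : Perm (Fin n) ⧸ youngSubgroup q, x ∈ MulAction.fixedBy _ σ ↔
      Φ x ∈ (rearr b).filter (fun f => f ∘ σ = f) := by
    intro x
    induction x using QuotientGroup.induction_on with
    | H g =>
      rw [Finset.mem_filter, MulAction.mem_fixedBy, hΦ, rearr_comp, mem_rearr,
        Tuple.sort_eq_refl_iff_monotone.2 hb]
      change ((σ * g : Perm (Fin n)) : Perm (Fin n) ⧸ youngSubgroup q) = g ↔ _
      rw [← hinj]
      constructor
      · intro e
        refine ⟨rfl, ?_⟩
        ext i
        have := congrFun e (σ i)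
        simp only [mul_inv_rev, Function.comp_apply, Perm.mul_apply, perm_inv_apply] at this
        exact this.symm
      · rintro ⟨-, e⟩
        ext i
        have := congrFun e (σ⁻¹ i)
        simp only [Function.comp_apply, perm_apply_inv] at this
        simp only [mul_inv_rev, Function.comp_apply, Perm.mul_apply]
        exact this.symm
  refine Nat.card_eq_of_bijective (fun x => ⟨Φ x.1, (hmem x.1).1 x.2⟩) ⟨?_, ?_⟩
  · rintro ⟨x, hx⟩ ⟨y, hy⟩ e
    simp only [Subtype.mk.injEq] at e ⊢
    induction x using QuotientGroup.induction_on with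
    | H g =>
      induction y using QuotientGroup.induction_on with
      | H g' => exact (hinj g g').1 e
  · rintro ⟨f, hf⟩
    have hf' := mem_rearr.1 (Finset.mem_filter.1 hf).1
    have : Φ ((Tuple.sort f : Perm (Fin n)) : Perm (Fin n) ⧸ youngSubgroup q) = f := by
      rw [hΦ, ← hf']
      ext i
      simp
    exact ⟨⟨_, (hmem _).2 (by rw [this]; exact hf)⟩, Subtype.ext this⟩

theorem exists_composition {n : ℕ} {α : Type*} [LinearOrder α] {b : Fin n → α}
    (hb : Monotone b) : ∃ q : Composition n, ∀ i j, q.index i = q.index j ↔ b i = b j := by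
  let S : Finset α := Finset.univ.image b
  let e : Fin #S ≃o S := S.orderIsoOfFin rfl
  let b' : Fin n → Fin #S := fun i => e.symm ⟨b i, Finset.mem_image_of_mem _ (Finset.mem_univ i)⟩
  have hb' : Monotone b' := fun i j hij => e.symm.monotone (by simpa using hb hij)
  have hinj : ∀ i j, b' i = b' j ↔ b i = b j := fun i j => by simp [b']
  have hsurj : ∀ t, ∃ i, b' i = t := by
    intro t
    obtain ⟨i, -, hi⟩ := Finset.mem_image.1 (e t).2
    refine ⟨i, ?_⟩
    apply e.injective
    rw [OrderIso.apply_symm_apply]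
    exact Subtype.ext hi
  let q : Composition n :=
    { blocks := List.ofFn fun t => #{i | b' i = t}
      blocks_pos := by
        intro x hx
        obtain ⟨t, rfl⟩ := (List.mem_ofFn' _ _).1 hx
        obtain ⟨i, hi⟩ := hsurj t
        exact Finset.card_pos.2 ⟨i, by simpa using hi⟩
      blocks_sum := by
        rw [List.sum_ofFn, ← Finset.card_eq_sum_card_fiberwise (fun _ _ => Finset.mem_univ _)]
        simp }
  have hlen : q.length = #S := by simp [q, Composition.length]
  have hsize : ∀ t : ℕ, t ≤ #S → q.sizeUpTo t = #{i | (b' i : ℕ) < t} := by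
    intro t
    induction t with
    | zero => intro _; simp
    | succ t ih =>
      intro ht
      rw [q.sizeUpTo_succ (by omega), ih (by omega)]
      have : q.blocks[t]'(by rw [q.blocks_length]; omega) = #{i | b' i = ⟨t, ht⟩} := by
        simp [q]
      rw [this, ← Finset.card_union_of_disjoint]
      · congr 1
        ext i
        simp only [Finset.mem_union, Finset.mem_filter, Finset.mem_univ, true_and, Fin.ext_iff]
        omega
      · rw [Finset.disjoint_left]
        intro i hi hi'
        simp only [Finset.mem_filter, Finset.mem_univ, true_and, Fin.ext_iff] at hi hi'
        omega
  have hindex : ∀ i, (q.index i : ℕ) = b' i := by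
    intro j
    have hj : (q.index j : ℕ) < #S := hlen ▸ (q.index j).2
    have h1 := q.lt_sizeUpTo_index_succ j
    have h2 := q.sizeUpTo_index_le j
    have hm : Monotone (fun i => (b' i : ℕ)) := fun _ _ h => hb' h
    rw [Fin.val_succ, hsize _ (by omega),
      Tuple.lt_card_lt_iff_apply_lt_of_monotone hm] at h1
    rw [hsize _ (by omega), ← not_lt, Tuple.lt_card_lt_iff_apply_lt_of_monotone hm] at h2
    omega
  exact ⟨q, fun i j => by rw [Fin.ext_iff, hindex, hindex, ← Fin.ext_iff, hinj]⟩

/-- The common multiplication rule of the `Ξ^q` and of the Young characters. -/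
theorem exists_mul_rule {n : ℕ} (q r : Composition n) : ∃ s : Multiset (Composition n),
    (∀ (F : Type*) [CommRing F], Xi F q * Xi F r = (s.map (Xi F)).sum) ∧
    ∀ σ, youngCharacter q σ * youngCharacter r σ = (s.map (youngCharacter · σ)).sum := by
  choose! c hc using fun (m : Fin n → Fin q.length ×ₗ Fin r.length) (hm : Monotone m) =>
    exists_composition hm
  have hM : ∀ m ∈ pairSorted q.index r.index, Monotone m := by
    intro m hm
    simp only [pairSorted, Finset.mem_filter] at hm
    exact hm.2.1
  refine ⟨(pairSorted q.index r.index).val.map c, ?_, ?_⟩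
  · intro F _
    rw [Multiset.map_map]
    change _ = ∑ m ∈ pairSorted q.index r.index, Xi F (c m)
    rw [Finset.sum_congr rfl fun m hm => Xi_eq_sum_rearr F (c m) (hM m hm) (hc m (hM m hm)),
      ← sum_pairWord, Xi_eq_sum_rearr F q (index_mono q) (fun _ _ => Iff.rfl),
      Xi_eq_sum_rearr F r (index_mono r) (fun _ _ => Iff.rfl), Finset.sum_mul_sum,
      Finset.sum_comm]
    rw [Finset.sum_comm (s := rearr q.index)]
    refine Finset.sum_congr rfl fun g _ => ?_
    refine Finset.sum_bij' (fun f _ => f ∘ ⇑(Tuple.sort g)⁻¹) (fun f _ => f ∘ ⇑(Tuple.sort g))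
      ?_ ?_ ?_ ?_ ?_
    · intro f hf; exact (rearr_comp _).2 hf
    · intro f hf; exact (rearr_comp _).2 hf
    · intro f hf; ext i; simp
    · intro f hf; ext i; simp
    · intro f hf
      rw [← sort_mul_sort]
      simp only [ofPerm]
      rw [← map_mul, ← MulOpposite.op_mul]
  · intro σ
    rw [Multiset.map_map]
    change _ = ∑ m ∈ pairSorted q.index r.index, youngCharacter (c m) σ
    rw [Finset.sum_congr rfl fun m hm => youngCharacter_eq (c m) (hM m hm) (hc m (hM m hm)) σ,
      ← sum_pairWord, youngCharacter_eq q (index_mono q) (fun _ _ => Iff.rfl),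
      youngCharacter_eq r (index_mono r) (fun _ _ => Iff.rfl), Finset.sum_mul_sum]
    refine Finset.sum_congr rfl fun f _ => Finset.sum_congr rfl fun g _ => ?_
    have : pairWord f g ∘ σ = pairWord f g ↔ f ∘ σ = f ∧ g ∘ σ = g := by
      simp only [funext_iff, pairWord, Function.comp_apply, toLex_inj, Prod.mk.injEq,
        forall_and]
    by_cases h1 : f ∘ σ = f <;> by_cases h2 : g ∘ σ = g <;> simp [this, h1, h2]

theorem exists_one_rule (n : ℕ) : ∃ q : Composition n,
    (∀ (F : Type*) [CommRing F], Xi F q = 1) ∧ ∀ σ, youngCharacter q σ = 1 := by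
  have hm : Monotone (fun _ : Fin n => (0 : Fin 1)) := monotone_const
  obtain ⟨q, hq⟩ := exists_composition hm
  have hr : rearr (fun _ : Fin n => (0 : Fin 1)) = {fun _ => 0} := by
    ext f
    simp only [mem_rearr, Finset.mem_singleton]
    exact ⟨fun _ => Subsingleton.elim _ _, fun _ => Subsingleton.elim _ _⟩
  refine ⟨q, fun F _ => ?_, fun σ => ?_⟩
  · rw [Xi_eq_sum_rearr F q hm hq, hr, Finset.sum_singleton,
      Tuple.sort_eq_refl_iff_monotone.2 hm]
    exact map_one (MonoidAlgebra.of F (Perm (Fin n))ᵐᵒᵖ)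
  · rw [youngCharacter_eq q hm hq, hr, Finset.sum_singleton]
    simp [Function.comp_def]

theorem lt_sizeUpTo_iff {n : ℕ} (q : Composition n) (i : Fin n) {t : ℕ} :
    (i : ℕ) < q.sizeUpTo t ↔ (q.index i : ℕ) < t := by
  have h1 := q.lt_sizeUpTo_index_succ i
  have h2 := q.sizeUpTo_index_le i
  constructor
  · intro h
    by_contra hc
    have := q.monotone_sizeUpTo (not_lt.1 hc)
    omega
  · intro h
    have : q.sizeUpTo (q.index i).succ ≤ q.sizeUpTo t :=
      q.monotone_sizeUpTo (by simpa using Nat.succ_le_of_lt h)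
    omega

theorem index_surjective {n : ℕ} (q : Composition n) : Function.Surjective q.index := fun t =>
  ⟨q.embedding t ⟨0, q.one_le_blocksFun t⟩, q.index_embedding t _⟩

theorem composition_eq_of_refines {n : ℕ} {q r : Composition n}
    (h : ∀ i j, r.index i = r.index j → q.index i = q.index j) (hl : r.length ≤ q.length) :
    r = q := by
  choose s hs using index_surjective r
  let φ : Fin r.length → Fin q.length := fun t => q.index (s t)
  have hφ : ∀ i, φ (r.index i) = q.index i := fun i => h _ _ (hs _)
  have hsurj : Function.Surjective φ := fun t => by
    obtain ⟨i, hi⟩ := index_surjective q t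
    exact ⟨r.index i, (hφ i).trans hi⟩
  have hlen : r.length = q.length :=
    le_antisymm hl (by simpa using Fintype.card_le_of_surjective φ hsurj)
  have hinj : Function.Injective φ :=
    ((Fintype.bijective_iff_surjective_and_card φ).2 ⟨hsurj, by simpa using hlen⟩).1
  have hmono : Monotone φ := by
    intro t t' htt
    rcases htt.eq_or_lt with rfl | hlt
    · exact le_rfl
    refine index_mono q (le_of_lt ?_)
    by_contra hc
    have := index_mono r (not_lt.1 hc)
    rw [hs, hs] at this
    exact absurd hlt (not_lt.2 this)
  have hstrict := hmono.strictMono_of_injective hinj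
  have hval : ∀ i, (r.index i : ℕ) = q.index i := by
    intro i
    rw [← hφ i]
    exact (Fin.coe_orderIso_apply (hstrict.orderIsoOfSurjective φ hsurj) (r.index i)).symm
  have hsize : ∀ t, r.sizeUpTo t = q.sizeUpTo t := by
    intro t
    have h1 : ∀ i : ℕ, i < n → (i < r.sizeUpTo t ↔ i < q.sizeUpTo t) := by
      intro i hi
      have e1 := lt_sizeUpTo_iff r ⟨i, hi⟩ (t := t)
      have e2 := lt_sizeUpTo_iff q ⟨i, hi⟩ (t := t)
      rw [hval] at e1
      exact e1.trans e2.symm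
    have hr := r.sizeUpTo_le t
    have hq := q.sizeUpTo_le t
    by_contra hne
    rcases Nat.lt_or_gt_of_ne hne with hlt | hlt
    · have := (h1 _ (by omega)).2 hlt
      omega
    · have := (h1 _ (by omega)).1 hlt
      omega
  apply Composition.ext
  apply List.ext_getElem
  · rw [r.blocks_length, q.blocks_length, hlen]
  · intro t h1 h2
    rw [r.blocks_length] at h1
    rw [q.blocks_length] at h2
    have e1 := r.sizeUpTo_succ h1
    have e2 := q.sizeUpTo_succ h2
    rw [hsize, hsize] at e1
    omega

/-- The permutation increasing on each block of `q` and decreasing from block to block. -/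
def topPerm {n : ℕ} (q : Composition n) : Perm (Fin n) :=
  (Tuple.sort (fun i => toLex (OrderDual.toDual (q.index i), i)))⁻¹

theorem topPerm_mem {n : ℕ} (q r : Composition n) :
    topPerm q ∈ incr r.index ↔ ∀ i j, r.index i = r.index j → q.index i = q.index j := by
  let f : Fin n → (Fin q.length)ᵒᵈ ×ₗ Fin n := fun i => toLex (OrderDual.toDual (q.index i), i)
  have hinj : Function.Injective f := fun i j h => by
    simp only [f, toLex_inj, Prod.mk.injEq] at h
    exact h.2
  have hs : StrictMono (f ∘ Tuple.sort f) :=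
    (Tuple.monotone_sort f).strictMono_of_injective (hinj.comp (Tuple.sort f).injective)
  have hlt : ∀ i j, topPerm q i < topPerm q j ↔ f i < f j := by
    intro i j
    rw [← hs.lt_iff_lt]
    simp only [topPerm, Function.comp_apply, f, perm_apply_inv]
  have hlt' : ∀ i j, i < j → (topPerm q i < topPerm q j ↔ q.index i = q.index j) := by
    intro i j hij
    rw [hlt, Prod.Lex.toLex_lt_toLex]
    have := index_mono q hij.le
    simp only [OrderDual.toDual_lt_toDual, OrderDual.toDual_inj, hij, and_true]
    exact ⟨fun h => h.resolve_left (not_lt.2 this), Or.inr⟩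
  rw [mem_incr]
  constructor
  · intro h i j hr
    rcases lt_trichotomy i j with hij | rfl | hij
    · exact (hlt' i j hij).1 (h i j hij hr)
    · rfl
    · exact ((hlt' j i hij).1 (h j i hij hr.symm)).symm
  · intro h i j hij hr
    exact (hlt' i j hij).2 (h i j hr)

theorem coeff_Xi (F : Type*) [CommRing F] {n : ℕ} (q : Composition n) (σ : Perm (Fin n)) :
    (Xi F q).coeff (MulOpposite.op σ) = if σ ∈ incr q.index then 1 else 0 := by
  rw [Xi_eq_sum_incr, MonoidAlgebra.coeff_sum, Finsupp.finsetSum_apply]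
  simp [ofPerm, MonoidAlgebra.of_apply, Finsupp.single_apply]

theorem linearIndependent_Xi (F : Type*) [CommRing F] (n : ℕ) :
    LinearIndependent F (Xi F : Composition n → SymGroupAlgebra F n) := by
  rw [Fintype.linearIndependent_iff]
  intro g hg
  by_contra! hne
  obtain ⟨q, hq, hmax⟩ := ({q | g q ≠ 0} : Finset (Composition n)).exists_max_image
    Composition.length (by obtain ⟨q, hq⟩ := hne; exact ⟨q, by simpa using hq⟩)
  simp only [Finset.mem_filter, Finset.mem_univ, true_and] at hq hmax
  apply hq
  have h := congrArg (fun x : SymGroupAlgebra F n => x.coeff (MulOpposite.op (topPerm q))) hg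
  simp only [MonoidAlgebra.coeff_sum, Finsupp.finsetSum_apply, MonoidAlgebra.coeff_smul,
    Finsupp.smul_apply, coeff_Xi, MonoidAlgebra.coeff_zero, Finsupp.zero_apply,
    smul_eq_mul] at h
  rw [Finset.sum_eq_single q] at h
  · rwa [if_pos ((topPerm_mem q q).2 fun _ _ => id), mul_one] at h
  · intro r _ hr
    by_cases h0 : g r = 0
    · rw [h0, zero_mul]
    · rw [if_neg, mul_zero]
      intro hm
      exact hr (composition_eq_of_refines ((topPerm_mem q r).1 hm) (hmax r h0))
  · intro h; exact absurd (Finset.mem_univ q) h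

/-! ### The descent algebra and its simple modules -/

/-- The descent algebra `D_n(F)`: the `F`-linear span of the elements `Ξ^q`, where `q` runs
through the compositions of `n`. -/
def descentAlgebra (F : Type*) [CommRing F] (n : ℕ) : Subalgebra F (SymGroupAlgebra F n) :=
  (Submodule.span F (Set.range (Xi F : Composition n → SymGroupAlgebra F n))).toSubalgebra
    (by
      obtain ⟨q, hq, -⟩ := exists_one_rule n
      rw [← hq F]
      exact Submodule.subset_span ⟨q, rfl⟩)
    (by
      intro x y hx hy
      induction hx, hy using Submodule.span_induction₂ with
      | mem_mem x y hx hy =>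
        obtain ⟨q, rfl⟩ := hx
        obtain ⟨r, rfl⟩ := hy
        obtain ⟨s, hs, -⟩ := exists_mul_rule q r
        rw [hs F]
        refine multiset_sum_mem _ ?_
        intro z hz
        obtain ⟨t, -, rfl⟩ := Multiset.mem_map.1 hz
        exact Submodule.subset_span ⟨t, rfl⟩
      | zero_left y hy => rw [zero_mul]; exact Submodule.zero_mem _
      | zero_right x hx => rw [mul_zero]; exact Submodule.zero_mem _
      | add_left x y z _ _ _ h1 h2 => rw [add_mul]; exact Submodule.add_mem _ h1 h2
      | add_right x y z _ _ _ h1 h2 => rw [mul_add]; exact Submodule.add_mem _ h1 h2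
      | smul_left r x y _ _ h => rw [smul_mul_assoc]; exact Submodule.smul_mem _ r h
      | smul_right r x y _ _ h => rw [mul_smul_comm]; exact Submodule.smul_mem _ r h)

/-- The basis of the descent algebra consisting of the `Ξ^q`. -/
def descentBasis (F : Type*) [CommRing F] (n : ℕ) :
    Module.Basis (Composition n) F (descentAlgebra F n) :=
  Module.Basis.span (linearIndependent_Xi F n)

theorem coe_descentBasis (F : Type*) [CommRing F] {n : ℕ} (q : Composition n) :
    (descentBasis F n q : SymGroupAlgebra F n) = Xi F q :=
  congrArg Subtype.val (Module.Basis.span_apply (linearIndependent_Xi F n) q)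

/-- The algebra homomorphism from the descent algebra to `F` that sends `Ξ^q` to `φ^q(σ)`,
i.e. evaluation at `σ` after Solomon's map. -/
def evalCharacter (F : Type*) [CommRing F] {n : ℕ} (σ : Perm (Fin n)) :
    descentAlgebra F n →ₐ[F] F :=
  AlgHom.ofLinearMap ((descentBasis F n).constr F fun q => (youngCharacter q σ : F))
    (by
      obtain ⟨q, hq, hφ⟩ := exists_one_rule n
      have h1 : (1 : descentAlgebra F n) = descentBasis F n q :=
        Subtype.ext (by rw [coe_descentBasis, hq F]; rfl)
      rw [h1, Module.Basis.constr_basis, hφ, Nat.cast_one])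
    (by
      set χ := (descentBasis F n).constr F fun q => (youngCharacter q σ : F) with hχ
      have key : (LinearMap.mul F (descentAlgebra F n)).compr₂ χ =
          (LinearMap.mul F F).compl₁₂ χ χ := by
        refine (descentBasis F n).ext fun q => (descentBasis F n).ext fun r => ?_
        obtain ⟨s, hs, hφ⟩ := exists_mul_rule q r
        have h1 : descentBasis F n q * descentBasis F n r =
            (s.map (descentBasis F n)).sum := by
          apply Subtype.ext
          change _ = (descentAlgebra F n).val _
          rw [map_multiset_sum, Multiset.map_map]
          simpa [coe_descentBasis] using hs F
        simp only [LinearMap.compr₂_apply, LinearMap.mul_apply', LinearMap.compl₁₂_apply]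
        rw [h1, map_multiset_sum, Multiset.map_map]
        simp only [hχ, Function.comp_def, Module.Basis.constr_basis]
        rw [← Nat.cast_mul, hφ, Nat.cast_multiset_sum, Multiset.map_map]
        rfl
      intro x y
      exact LinearMap.congr_fun (LinearMap.congr_fun key x) y)

theorem evalCharacter_descentBasis (F : Type*) [CommRing F] {n : ℕ} (σ : Perm (Fin n))
    (q : Composition n) : evalCharacter F σ (descentBasis F n q) = (youngCharacter q σ : F) :=
  (descentBasis F n).constr_basis F _ q

theorem exists_perm_of_partition {n : ℕ} (l : n.Partition) :
    ∃ σ : Perm (Fin n), σ.partition.parts = l.parts := by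
  obtain ⟨σ, hσ⟩ := (Perm.exists_with_cycleType_iff (Fin n) (m := l.parts.filter (2 ≤ ·))).2
    ⟨by
      rw [Fintype.card_fin]
      conv_rhs => rw [← l.parts_sum, ← Multiset.filter_add_not (2 ≤ ·) l.parts, Multiset.sum_add]
      exact Nat.le_add_right _ _, fun a ha => (Multiset.mem_filter.1 ha).2⟩
  refine ⟨σ, ?_⟩
  have h1 : l.parts.filter (fun a => ¬ 2 ≤ a) =
      Multiset.replicate (Multiset.card (l.parts.filter (fun a => ¬ 2 ≤ a))) 1 := by
    rw [Multiset.eq_replicate_card]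
    intro b hb
    have h2 := l.parts_pos (Multiset.mem_filter.1 hb).1
    have h3 := (Multiset.mem_filter.1 hb).2
    omega
  have hsum := l.parts_sum
  rw [← Multiset.filter_add_not (2 ≤ ·) l.parts, Multiset.sum_add, h1,
    Multiset.sum_replicate, smul_eq_mul, mul_one] at hsum
  rw [Perm.parts_partition, hσ, ← Perm.sum_cycleType, hσ, Fintype.card_fin]
  conv_rhs => rw [← Multiset.filter_add_not (2 ≤ ·) l.parts, h1]
  congr 2
  omega

/-- A permutation of cycle type `l`. -/
def permOfPartition {n : ℕ} (l : n.Partition) : Perm (Fin n) :=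
  (exists_perm_of_partition l).choose

theorem partition_permOfPartition {n : ℕ} (l : n.Partition) :
    (permOfPartition l).partition.parts = l.parts :=
  (exists_perm_of_partition l).choose_spec

/-- The character of the simple module `M_λ`: it sends `Ξ^q` to `φ^q(λ)`. -/
def simpleCharacter (F : Type*) [CommRing F] {n : ℕ} (l : n.Partition) :
    descentAlgebra F n →ₐ[F] F :=
  evalCharacter F (permOfPartition l)

/-- The one-dimensional module `M_λ` of the descent algebra. -/
def SimpleModule (F : Type*) {n : ℕ} (_ : n.Partition) : Type _ := F

instance (F : Type*) [CommRing F] {n : ℕ} (l : n.Partition) : AddCommGroup (SimpleModule F l) :=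
  inferInstanceAs (AddCommGroup F)

/-- An element `x` of the descent algebra acts on `M_λ` as its character value at `λ`. -/
instance (F : Type*) [CommRing F] {n : ℕ} (l : n.Partition) :
    Module (descentAlgebra F n) (SimpleModule F l) :=
  Module.compHom F (simpleCharacter F l).toRingHom

/-! ### The Ext quiver -/

/-- `p`-regular partitions of `n`: every part occurs at most `p - 1` times. The value `p = 0`
stands for characteristic zero, where there is no condition. -/
def IsPRegular (p : ℕ) {n : ℕ} (l : n.Partition) : Prop :=
  p = 0 ∨ ∀ i, l.parts.count i < p

theorem isPRegular_of_lt {p n : ℕ} (h : p = 0 ∨ n < p) (l : n.Partition) : IsPRegular p l := by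
  refine h.imp_right fun h i => lt_of_le_of_lt ?_ h
  have h1 : Multiset.card l.parts ≤ n := by
    have := Multiset.card_nsmul_le_sum (s := l.parts) (a := 1) fun x hx => l.parts_pos hx
    simpa [l.parts_sum] using this
  exact (Multiset.count_le_card i _).trans h1

/-- The dimension of `Ext¹(M_λ, M_μ)` over the descent algebra. -/
def extDim (F : Type*) [Field F] {n : ℕ} (l m : n.Partition) : ℕ :=
  Module.finrank F (CategoryTheory.Abelian.Ext
    (ModuleCat.of (descentAlgebra F n) (SimpleModule F l))
    (ModuleCat.of (descentAlgebra F n) (SimpleModule F m)) 1)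

/-- The vertices of the Ext quiver `Q_{n,p}` of the descent algebra `D_n(F)`, where `p` is the
characteristic of `F`: the `p`-regular partitions of `n`, which label the simple modules. -/
def ExtQuiver (_F : Type*) (p n : ℕ) : Type :=
  {l : n.Partition // IsPRegular p l}

instance (F : Type*) (p n : ℕ) : Fintype (ExtQuiver F p n) :=
  inferInstanceAs (Fintype {l : n.Partition // IsPRegular p l})

/-- The number of arrows from `λ` to `μ` is the dimension of `Ext¹(M_λ, M_μ)`. -/
instance (F : Type*) [Field F] (p n : ℕ) : Quiver (ExtQuiver F p n) where
  Hom l m := Fin (extDim F l.1 m.1)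

/-- If `p = 0` or `p > n`, then every partition of `n` is a vertex of `Q_{n,p}`. -/
def ExtQuiver.ofPartition (F : Type*) {p n : ℕ} (h : p = 0 ∨ n < p) (l : n.Partition) :
    ExtQuiver F p n :=
  ⟨l, isPRegular_of_lt h l⟩

/-- The partition `6` of `6`. -/
def partition6 : Nat.Partition 6 where
  parts := {6}
  parts_pos := by decide
  parts_sum := by decide

/-- The partition `2²1²` of `6`. -/
def partition2211 : Nat.Partition 6 where
  parts := {2, 2, 1, 1}
  parts_pos := by decide
  parts_sum := by decide

/-! ### Path algebras -/

/-- All paths of a quiver, with source `p.1`, target `p.2.1` and underlying path `p.2.2`. -/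
abbrev AllPaths (V : Type*) [Quiver V] : Type _ := Σ a b : V, Quiver.Path a b

/-- The composition `β α` of paths (first `α`, then `β`), if the source of `β` is the target
of `α`. -/
def AllPaths.comp {V : Type*} [Quiver V] (β α : AllPaths V) : Option (AllPaths V) :=
  if h : α.2.1 = β.1 then some ⟨α.1, β.2.1, α.2.2.comp (β.2.2.cast h.symm rfl)⟩ else none

theorem AllPaths.comp_of_eq {V : Type*} [Quiver V] {a b c : V} (α : Quiver.Path a b)
    (β : Quiver.Path b c) :
    AllPaths.comp (⟨b, c, β⟩ : AllPaths V) ⟨a, b, α⟩ = some ⟨a, c, α.comp β⟩ :=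
  dif_pos rfl

theorem AllPaths.comp_of_ne {V : Type*} [Quiver V] {β α : AllPaths V} (h : α.2.1 ≠ β.1) :
    AllPaths.comp β α = none :=
  dif_neg h

/-- The path algebra `F Q` of a quiver `Q`: formal `F`-linear combinations of paths. -/
def PathAlgebra (F : Type*) [CommRing F] (V : Type*) [Quiver V] : Type _ :=
  AllPaths V →₀ F

namespace PathAlgebra

instance (F : Type*) [CommRing F] (V : Type*) [Quiver V] : AddCommGroup (PathAlgebra F V) :=
  inferInstanceAs (AddCommGroup (AllPaths V →₀ F))

instance (F : Type*) [CommRing F] (V : Type*) [Quiver V] : Module F (PathAlgebra F V) :=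
  inferInstanceAs (Module F (AllPaths V →₀ F))

/-- The basis of the path algebra given by the paths. -/
def basis (F : Type*) [CommRing F] (V : Type*) [Quiver V] :
    Module.Basis (AllPaths V) F (PathAlgebra F V) :=
  Module.Basis.ofRepr (LinearEquiv.refl F (AllPaths V →₀ F))

/-- The product of two paths: their composition if it is defined, and zero otherwise. -/
def mulPaths (F : Type*) [CommRing F] {V : Type*} [Quiver V] (β α : AllPaths V) :
    PathAlgebra F V :=
  (AllPaths.comp β α).elim 0 (basis F V)

/-- The bilinear extension of the product of paths. -/
def mulHom (F : Type*) [CommRing F] (V : Type*) [Quiver V] :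
    PathAlgebra F V →ₗ[F] PathAlgebra F V →ₗ[F] PathAlgebra F V :=
  (basis F V).constr F fun β => (basis F V).constr F fun α => mulPaths F β α

instance (F : Type*) [CommRing F] (V : Type*) [Quiver V] : Mul (PathAlgebra F V) where
  mul x y := mulHom F V x y

/-- The path of length zero `e_v` at a vertex `v`. -/
def vertex (F : Type*) [CommRing F] {V : Type*} [Quiver V] (v : V) : PathAlgebra F V :=
  basis F V ⟨v, v, Quiver.Path.nil⟩

/-- The identity is the sum of the paths of length zero. -/
instance (F : Type*) [CommRing F] (V : Type*) [Fintype V] [Quiver V] : One (PathAlgebra F V) where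
  one := ∑ v, vertex F v

theorem mul_def {F : Type*} [CommRing F] {V : Type*} [Quiver V] (x y : PathAlgebra F V) :
    x * y = mulHom F V x y := rfl

theorem basis_mul_basis (F : Type*) [CommRing F] {V : Type*} [Quiver V] (β α : AllPaths V) :
    basis F V β * basis F V α = mulPaths F β α := by
  rw [mul_def, mulHom, Module.Basis.constr_basis, Module.Basis.constr_basis]

theorem basis_mul_of_eq (F : Type*) [CommRing F] {V : Type*} [Quiver V] {a b c : V}
    (α : Quiver.Path a b) (β : Quiver.Path b c) :
    basis F V ⟨b, c, β⟩ * basis F V ⟨a, b, α⟩ = basis F V ⟨a, c, α.comp β⟩ := by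
  rw [basis_mul_basis, mulPaths, AllPaths.comp_of_eq]
  rfl

theorem basis_mul_of_ne (F : Type*) [CommRing F] {V : Type*} [Quiver V] {β α : AllPaths V}
    (h : α.2.1 ≠ β.1) : basis F V β * basis F V α = 0 := by
  rw [basis_mul_basis, mulPaths, AllPaths.comp_of_ne h]
  rfl

theorem zero_mul' {F : Type*} [CommRing F] {V : Type*} [Quiver V] (x : PathAlgebra F V) :
    0 * x = 0 := by
  rw [mul_def, map_zero, LinearMap.zero_apply]

theorem mul_zero' {F : Type*} [CommRing F] {V : Type*} [Quiver V] (x : PathAlgebra F V) :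
    x * 0 = 0 := by
  rw [mul_def, map_zero]

theorem basis_mul_assoc (F : Type*) [CommRing F] {V : Type*} [Quiver V] (γ β α : AllPaths V) :
    basis F V γ * basis F V β * basis F V α = basis F V γ * (basis F V β * basis F V α) := by
  obtain ⟨a, b, α⟩ := α
  obtain ⟨b', c, β⟩ := β
  obtain ⟨c', d, γ⟩ := γ
  by_cases h1 : b = b' <;> by_cases h2 : c = c'
  · subst h1 h2
    rw [basis_mul_of_eq, basis_mul_of_eq, basis_mul_of_eq, basis_mul_of_eq,
      Quiver.Path.comp_assoc]
  · subst h1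
    rw [basis_mul_of_eq, basis_mul_of_ne F (β := ⟨c', d, γ⟩) (α := ⟨b, c, β⟩) h2,
      basis_mul_of_ne F (β := ⟨c', d, γ⟩) (α := ⟨a, c, α.comp β⟩) h2, zero_mul']
  · subst h2
    rw [basis_mul_of_eq, basis_mul_of_ne F (β := ⟨b', c, β⟩) (α := ⟨a, b, α⟩) h1,
      basis_mul_of_ne F (β := ⟨b', d, β.comp γ⟩) (α := ⟨a, b, α⟩) h1, mul_zero']
  · rw [basis_mul_of_ne F (β := ⟨b', c, β⟩) (α := ⟨a, b, α⟩) h1,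
      basis_mul_of_ne F (β := ⟨c', d, γ⟩) (α := ⟨b', c, β⟩) h2, mul_zero', zero_mul']

theorem mul_assoc' {F : Type*} [CommRing F] {V : Type*} [Quiver V] (x y z : PathAlgebra F V) :
    x * y * z = x * (y * z) := by
  let B := mulHom F V
  have h1 : ∀ γ β : AllPaths V, ∀ z, basis F V γ * basis F V β * z =
      basis F V γ * (basis F V β * z) := fun γ β z =>
    LinearMap.congr_fun (f := B (basis F V γ * basis F V β))
      (g := B (basis F V γ) ∘ₗ B (basis F V β))
      ((basis F V).ext fun α => basis_mul_assoc F γ β α) z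
  have h2 : ∀ γ : AllPaths V, ∀ y z, basis F V γ * y * z = basis F V γ * (y * z) := fun γ y z =>
    LinearMap.congr_fun (f := B.flip z ∘ₗ B (basis F V γ)) (g := B (basis F V γ) ∘ₗ B.flip z)
      ((basis F V).ext fun β => h1 γ β z) y
  exact LinearMap.congr_fun (f := B.flip z ∘ₗ B.flip y) (g := B.flip (y * z))
    ((basis F V).ext fun γ => h2 γ y z) x

theorem vertex_mul_basis (F : Type*) [CommRing F] {V : Type*} [Quiver V] (v : V)
    (α : AllPaths V) : vertex F v * basis F V α = if α.2.1 = v then basis F V α else 0 := by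
  obtain ⟨a, b, α⟩ := α
  split_ifs with h
  · subst h
    exact basis_mul_of_eq F α Quiver.Path.nil
  · exact basis_mul_of_ne F h

theorem basis_mul_vertex (F : Type*) [CommRing F] {V : Type*} [Quiver V] (v : V)
    (α : AllPaths V) : basis F V α * vertex F v = if v = α.1 then basis F V α else 0 := by
  obtain ⟨a, b, α⟩ := α
  split_ifs with h
  · subst h
    refine (basis_mul_of_eq F Quiver.Path.nil α).trans ?_
    rw [Quiver.Path.nil_comp]
  · exact basis_mul_of_ne F h

instance (F : Type*) [CommRing F] (V : Type*) [Fintype V] [Quiver V] :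
    Ring (PathAlgebra F V) where
  __ := (inferInstance : AddCommGroup (PathAlgebra F V))
  left_distrib x y z := map_add (mulHom F V x) y z
  right_distrib x y z := by
    simp only [mul_def]
    rw [map_add, LinearMap.add_apply]
  zero_mul := zero_mul'
  mul_zero := mul_zero'
  mul_assoc := mul_assoc'
  one_mul x := by
    change mulHom F V (∑ v, vertex F v) x = x
    refine LinearMap.congr_fun (f := mulHom F V (∑ v, vertex F v)) (g := LinearMap.id)
      ((basis F V).ext fun α => ?_) x
    rw [map_sum, LinearMap.sum_apply]
    simp only [← mul_def, vertex_mul_basis]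
    simp
  mul_one x := by
    change (mulHom F V).flip (∑ v, vertex F v) x = x
    refine LinearMap.congr_fun (f := (mulHom F V).flip (∑ v, vertex F v)) (g := LinearMap.id)
      ((basis F V).ext fun α => ?_) x
    rw [map_sum, LinearMap.sum_apply]
    simp only [LinearMap.flip_apply, ← mul_def, basis_mul_vertex]
    simp

instance (F : Type*) [CommRing F] (V : Type*) [Fintype V] [Quiver V] :
    Algebra F (PathAlgebra F V) :=
  Algebra.ofModule
    (fun r x y => by rw [mul_def, mul_def, map_smul, LinearMap.smul_apply])
    (fun r x y => by rw [mul_def, mul_def, map_smul])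

/-- The linear span of the paths of length at least `k`, i.e. the ideal `(F Q⁺)^k`. -/
def longPaths (F : Type*) [CommRing F] (V : Type*) [Quiver V] (k : ℕ) :
    Submodule F (PathAlgebra F V) :=
  Submodule.span F {x | ∃ α : AllPaths V, k ≤ α.2.2.length ∧ x = basis F V α}

end PathAlgebra

end DescentAlg

end

/-! A composition of 6 is a set `C` of cuts among five positions, so the basis `Ξ^q` has 32
elements. Multiplying `Ξ^C` on the right can only add cuts. The right regular representation is
therefore triangular for inclusion, and its diagonal entry at `C` is the simple character of the
partition formed by the blocks of `C` (`regCoeff_self_eq_chi`). Hence the common kernel of the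
eleven characters consists of nilpotent elements. In characteristic 0 or at least 7 the characters
are distinct, and the coordinate idempotents of `F^11` lift to a complete orthogonal family `e`
(`exists_idempotents`).

There is an arrow from λ to μ exactly when μ arises from λ by adding two different parts. It is
represented by `e_μ * (Ξ^(6-j,j) - Ξ^(j,6-j)) * e_λ`, where `j` is the smaller of these parts. Such
an element adds at least one cut, so the product along a path of length `k` adds at least `k` cuts.
Its matrix entries with exactly `k` new cuts are explicit integers that do not depend on the chosen
lifts (`IsDualFamily.regCoeff_pathProd`). A finite check of these integers shows that 32 of the 33
paths have linearly independent products, which therefore form a basis.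

This basis determines the quiver. With `K` the kernel of the character of `M_λ`, `Ext¹(M_λ, M_μ)` is
`Hom(K, M_μ)` modulo the restrictions of maps from the whole algebra, and such a map on `K` is
controlled by its value on the arrow from λ to μ. The path left out of the basis leads from `2²1²`
to `6`. The corner cut out by the idempotents of its ends is spanned by the product along the one
standard path with these ends, which gives one relation, and independence of the other products
excludes any further one. -/

noncomputable section

namespace DescentAlg

open Equiv Finset

/-! ### Cut sets and the multiplication rule -/

section CutSet

variable {n : ℕ} {α β : Type*}

/-- The positions at which the letter of a word changes. -/
def cutSet [DecidableEq α] (m : Fin (n + 1) → α) : Finset (Fin n) :=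
  {i | m i.castSucc ≠ m i.succ}

theorem notMem_cutSet [DecidableEq α] {m : Fin (n + 1) → α} {i : Fin n} :
    i ∉ cutSet m ↔ m i.castSucc = m i.succ := by
  simp [cutSet]

/-- A monotone word with equal letters at two positions is constant between them. It has no cut
there, and a word with fewer cuts has none either. -/
theorem eq_of_cutSet_subset [LinearOrder α] [DecidableEq β] {b : Fin (n + 1) → α}
    {b' : Fin (n + 1) → β} (hb : Monotone b) (h : cutSet b' ⊆ cutSet b) {i j : Fin (n + 1)}
    (hij : b i = b j) : b' i = b' j := by
  have key : ∀ j i : Fin (n + 1), i ≤ j → b i = b j → b' i = b' j := by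
    intro j
    induction j using Fin.induction with
    | zero => intro i hi _; rw [Fin.le_zero_iff.1 hi]
    | succ k ih =>
      intro i hi hij
      rcases hi.eq_or_lt with rfl | hlt
      · rfl
      have h1 : i ≤ k.castSucc := Fin.le_castSucc_iff.2 hlt
      have h2 : b k.castSucc = b k.succ :=
        le_antisymm (hb (Fin.castSucc_lt_succ).le) (hij ▸ hb h1)
      rw [ih i h1 (hij.trans h2.symm)]
      exact notMem_cutSet.1 fun hk => notMem_cutSet.2 h2 (h hk)
  rcases le_total i j with h1 | h1
  · exact key j i h1 hij
  · exact (key i j h1 hij.symm).symm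

theorem eq_iff_of_cutSet_eq [LinearOrder α] [LinearOrder β] {b : Fin (n + 1) → α}
    {b' : Fin (n + 1) → β} (hb : Monotone b) (hb' : Monotone b') (h : cutSet b = cutSet b')
    (i j : Fin (n + 1)) : b i = b j ↔ b' i = b' j :=
  ⟨eq_of_cutSet_subset hb h.symm.subset, eq_of_cutSet_subset hb' h.subset⟩

theorem cutSet_index_injective :
    Function.Injective fun q : Composition (n + 1) => cutSet q.index := by
  intro q r h
  have h1 := eq_iff_of_cutSet_eq (index_mono q) (index_mono r) h
  rcases le_total r.length q.length with hl | hl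
  · exact (composition_eq_of_refines (fun i j => (h1 i j).2) hl).symm
  · exact composition_eq_of_refines (fun i j => (h1 i j).1) hl

/-- Compositions of `n + 1` correspond to subsets of the `n` possible cuts. -/
def cutEquiv (n : ℕ) : Composition (n + 1) ≃ Finset (Fin n) :=
  Equiv.ofBijective (fun q => cutSet q.index)
    ((Fintype.bijective_iff_injective_and_card _).2
      ⟨cutSet_index_injective, by simp [composition_card]⟩)

/-- The composition with a given set of cuts. -/
def ofCuts (C : Finset (Fin n)) : Composition (n + 1) := (cutEquiv n).symm C

theorem cutSet_ofCuts (C : Finset (Fin n)) : cutSet (ofCuts C).index = C :=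
  (cutEquiv n).apply_symm_apply C

/-- The basis `Ξ^q` of the descent algebra, indexed by sets of cuts. -/
def cutBasis (F : Type*) [CommRing F] (n : ℕ) :
    Module.Basis (Finset (Fin n)) F (descentAlgebra F (n + 1)) :=
  (descentBasis F (n + 1)).reindex (cutEquiv n)

theorem coe_cutBasis (F : Type*) [CommRing F] (C : Finset (Fin n)) :
    (cutBasis F n C : SymGroupAlgebra F (n + 1)) = Xi F (ofCuts C) := by
  rw [cutBasis, Module.Basis.reindex_apply, coe_descentBasis]
  rfl

theorem coe_cutBasis_eq_sum (F : Type*) [CommRing F] [Fintype α] [LinearOrder α]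
    {b : Fin (n + 1) → α} (hb : Monotone b) :
    (cutBasis F n (cutSet b) : SymGroupAlgebra F (n + 1)) =
      ∑ f ∈ rearr b, ofPerm F (Tuple.sort f) := by
  rw [coe_cutBasis, Xi_eq_sum_rearr F _ hb]
  exact eq_iff_of_cutSet_eq (index_mono _) hb (cutSet_ofCuts _)

theorem cutSet_pairWord [DecidableEq α] [DecidableEq β] [DecidableEq (α ×ₗ β)]
    (b : Fin (n + 1) → α) (g : Fin (n + 1) → β) :
    cutSet (pairWord b g) = cutSet b ∪ cutSet g := by
  ext i
  rw [mem_union, ← not_iff_not, not_or, notMem_cutSet, notMem_cutSet, notMem_cutSet]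
  simp [pairWord]

theorem monotone_pairWord_iff [LinearOrder α] [LinearOrder β] {b : Fin (n + 1) → α}
    (hb : Monotone b) (g : Fin (n + 1) → β) :
    Monotone (pairWord b g) ↔ ∀ i ∉ cutSet b, g i.castSucc ≤ g i.succ := by
  rw [Fin.monotone_iff_le_succ]
  refine forall_congr' fun i => ?_
  rw [notMem_cutSet, pairWord, pairWord, Prod.Lex.toLex_le_toLex]
  have h1 := hb (Fin.castSucc_lt_succ (i := i)).le
  constructor
  · rintro (h | h) he
    · exact absurd he h.ne
    · exact h.2
  · intro h
    rcases h1.lt_or_eq with h2 | h2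
    · exact Or.inl h2
    · exact Or.inr ⟨h2, h h2⟩

theorem rearr_eq_of_monotone [Fintype α] [LinearOrder α] {b f : Fin n → α} (hf : Monotone f)
    (h : f ∈ rearr b) : f = b := by
  rw [mem_rearr, Tuple.sort_eq_refl_iff_monotone.2 hf] at h
  exact h

/-- The first components of a sorted word of pairs form a weakly increasing rearrangement of the
monotone word `b`, hence `b` itself. Only the second component is free. -/
theorem mem_pairSorted_iff [Fintype α] [LinearOrder α] [Fintype β] [LinearOrder β]
    {b : Fin (n + 1) → α} (hb : Monotone b) {b' : Fin (n + 1) → β}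
    {m : Fin (n + 1) → α ×ₗ β} :
    m ∈ pairSorted b b' ↔ ∃ g ∈ rearr b', (∀ i ∉ cutSet b, g i.castSucc ≤ g i.succ) ∧
      pairWord b g = m := by
  simp only [pairSorted, mem_filter, mem_univ, true_and]
  constructor
  · rintro ⟨h1, h2, h3⟩
    have h4 : (fun i => (ofLex (m i)).1) = b :=
      rearr_eq_of_monotone (fun i j hij => (Prod.Lex.monotone_fst _ _ (h1 hij))) h2
    have h5 : pairWord b (fun i => (ofLex (m i)).2) = m := by rw [← h4]; rfl
    exact ⟨_, h3, (monotone_pairWord_iff hb _).1 (by rwa [h5]), h5⟩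
  · rintro ⟨g, h1, h2, rfl⟩
    refine ⟨(monotone_pairWord_iff hb g).2 h2, ?_, h1⟩
    change b ∈ rearr b
    rw [mem_rearr, Tuple.sort_eq_refl_iff_monotone.2 hb]
    rfl

/-- The product of two basis elements: a sum over the rearrangements `g` of a word for the second
factor which increase weakly on the blocks of the first one. -/
theorem cutBasis_mul_cutBasis (F : Type*) [CommRing F] [Fintype α] [LinearOrder α]
    (C : Finset (Fin n)) {b : Fin (n + 1) → α} (hb : Monotone b) :
    cutBasis F n C * cutBasis F n (cutSet b) =
      ∑ g ∈ rearr b with ∀ i ∉ C, g i.castSucc ≤ g i.succ, cutBasis F n (C ∪ cutSet g) := by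
  apply Subtype.ext
  set c := (ofCuts C).index with hc
  have hcm : Monotone c := index_mono _
  have hC : cutSet c = C := cutSet_ofCuts C
  rw [← hC]
  -- The admissible `g` are exactly the second components of the sorted pair words, and pairing with
  -- `c` unites the two sets of cuts.
  have hsum : ((∑ g ∈ rearr b with ∀ i ∉ cutSet c, g i.castSucc ≤ g i.succ,
      cutBasis F n (cutSet c ∪ cutSet g) : descentAlgebra F (n + 1)) : SymGroupAlgebra F (n + 1)) =
      ∑ m ∈ pairSorted c b, ∑ h ∈ rearr m, ofPerm F (Tuple.sort h) := by
    rw [AddSubmonoidClass.coe_finsetSum]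
    refine Finset.sum_bij (fun g _ => pairWord c g) ?_ ?_ ?_ ?_
    · intro g hg
      rw [mem_filter] at hg
      exact (mem_pairSorted_iff hcm).2 ⟨g, hg.1, hg.2, rfl⟩
    · intro g _ g' _ h
      ext i
      have := congrFun h i
      simp only [pairWord, toLex_inj, Prod.mk.injEq] at this
      exact this.2
    · intro m hm
      obtain ⟨g, h1, h2, h3⟩ := (mem_pairSorted_iff hcm).1 hm
      exact ⟨g, mem_filter.2 ⟨h1, h2⟩, h3⟩
    · intro g hg
      rw [mem_filter] at hg
      rw [← cutSet_pairWord, coe_cutBasis_eq_sum F ((monotone_pairWord_iff hcm g).2 hg.2)]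
  rw [hsum, ← sum_pairWord, MulMemClass.coe_mul, coe_cutBasis_eq_sum F hcm,
    coe_cutBasis_eq_sum F hb, Finset.sum_mul_sum]
  rw [Finset.sum_comm, Finset.sum_comm (s := rearr c)]
  refine Finset.sum_congr rfl fun g _ => ?_
  -- This substitution is the one under which `sort_mul_sort` merges two sorting permutations into
  -- the sorting permutation of a word of pairs.
  refine Finset.sum_bij' (fun f _ => f ∘ ⇑(Tuple.sort g)⁻¹) (fun f _ => f ∘ ⇑(Tuple.sort g))
    ?_ ?_ ?_ ?_ ?_
  · intro f hf; exact (rearr_comp _).2 hf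
  · intro f hf; exact (rearr_comp _).2 hf
  · intro f hf; ext i; simp
  · intro f hf; ext i; simp
  · intro f hf
    rw [← sort_mul_sort]
    simp only [ofPerm]
    rw [← map_mul, ← MulOpposite.op_mul]

theorem cutBasis_empty (F : Type*) [CommRing F] (n : ℕ) : cutBasis F n ∅ = 1 := by
  have hm : Monotone (fun _ : Fin (n + 1) => (0 : Fin 1)) := monotone_const
  have hr : rearr (fun _ : Fin (n + 1) => (0 : Fin 1)) = {fun _ => 0} := by
    ext f
    simp only [mem_rearr, Finset.mem_singleton]
    exact ⟨fun _ => Subsingleton.elim _ _, fun _ => Subsingleton.elim _ _⟩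
  have hc : cutSet (fun _ : Fin (n + 1) => (0 : Fin 1)) = ∅ := by
    ext i; simp [cutSet]
  apply Subtype.ext
  rw [← hc, coe_cutBasis_eq_sum F hm, hr, Finset.sum_singleton,
    Tuple.sort_eq_refl_iff_monotone.2 hm]
  exact map_one (MonoidAlgebra.of F (Perm (Fin (n + 1)))ᵐᵒᵖ)

end CutSet

/-! ### The right regular representation -/

section Regular

variable {n : ℕ} (F : Type*) [CommRing F]

/-- The matrix entries of the right regular representation with respect to the basis of
the `Ξ^q`. -/
def regCoeff (C D : Finset (Fin n)) : descentAlgebra F (n + 1) →ₗ[F] F :=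
  (cutBasis F n).coord D ∘ₗ LinearMap.mulLeft F (cutBasis F n C)

variable {F}

theorem cutBasis_mul_eq_sum (C : Finset (Fin n)) (x : descentAlgebra F (n + 1)) :
    cutBasis F n C * x = ∑ E, regCoeff F C E x • cutBasis F n E :=
  ((cutBasis F n).sum_repr _).symm

/-- The row index belongs to the basis element being multiplied. With this convention right
multiplication gives a homomorphism to matrices and not an antihomomorphism. -/
theorem regCoeff_mul (C D : Finset (Fin n)) (x y : descentAlgebra F (n + 1)) :
    regCoeff F C D (x * y) = ∑ E, regCoeff F C E x * regCoeff F E D y := by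
  have h : cutBasis F n C * (x * y) = ∑ E, regCoeff F C E x • (cutBasis F n E * y) := by
    rw [← mul_assoc, cutBasis_mul_eq_sum, Finset.sum_mul]
    simp only [smul_mul_assoc]
  change (cutBasis F n).coord D (cutBasis F n C * (x * y)) = _
  rw [h, map_sum]
  simp only [map_smul, smul_eq_mul]
  rfl

theorem eq_zero_of_regCoeff {x : descentAlgebra F (n + 1)} (h : ∀ D, regCoeff F ∅ D x = 0) :
    x = 0 := by
  rw [← one_mul x, ← cutBasis_empty, cutBasis_mul_eq_sum]
  simp [h]

theorem regCoeff_cutBasis {α : Type*} [Fintype α] [LinearOrder α] (C D : Finset (Fin n))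
    {b : Fin (n + 1) → α} (hb : Monotone b) :
    regCoeff F C D (cutBasis F n (cutSet b)) =
      (#{g ∈ rearr b | (∀ i ∉ C, g i.castSucc ≤ g i.succ) ∧ C ∪ cutSet g = D} : ℕ) := by
  change (cutBasis F n).coord D (cutBasis F n C * _) = _
  rw [cutBasis_mul_cutBasis F C hb, map_sum, ← Finset.filter_filter, Finset.card_filter,
    Nat.cast_sum]
  refine Finset.sum_congr rfl fun g _ => ?_
  rw [Module.Basis.coord_apply, Module.Basis.repr_self, Finsupp.single_apply]
  push_cast
  rfl

theorem cutBasis_induction {p : descentAlgebra F (n + 1) → Prop}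
    (h : ∀ (m : ℕ) (b : Fin (n + 1) → Fin m), Monotone b → p (cutBasis F n (cutSet b)))
    (hadd : ∀ x y, p x → p y → p (x + y)) (hsmul : ∀ (a : F) x, p x → p (a • x)) (h0 : p 0)
    (x : descentAlgebra F (n + 1)) : p x := by
  rw [← (cutBasis F n).sum_repr x]
  refine Finset.sum_induction _ p hadd h0 fun C _ => hsmul _ _ ?_
  rw [← cutSet_ofCuts C]
  exact h _ _ (index_mono _)

/-- Triangularity: every term of the product rule is indexed by `C ∪ cutSet g`. -/
theorem regCoeff_eq_zero {C D : Finset (Fin n)} (hCD : ¬ C ⊆ D)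
    (x : descentAlgebra F (n + 1)) : regCoeff F C D x = 0 := by
  induction x using cutBasis_induction with
  | h m b hb =>
    rw [regCoeff_cutBasis C D hb, Finset.filter_false_of_mem, Finset.card_empty, Nat.cast_zero]
    rintro g _ ⟨-, rfl⟩
    exact hCD subset_union_left
  | hadd x y hx hy => rw [map_add, hx, hy, add_zero]
  | hsmul a x hx => rw [map_smul, hx, smul_zero]
  | h0 => exact map_zero _

/-- The product of the adjacent transpositions inside the blocks; its cycles are the blocks. -/
def cutPerm (C : Finset (Fin n)) : Perm (Fin (n + 1)) :=
  (((List.finRange n).filter (· ∉ C)).map fun i => swap i.castSucc i.succ).prod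

theorem comp_list_prod {α : Type*} {m : ℕ} (f : Fin m → α) (l : List (Perm (Fin m)))
    (h : ∀ σ ∈ l, f ∘ σ = f) : f ∘ ⇑l.prod = f := by
  induction l with
  | nil => rfl
  | cons σ l ih =>
    rw [List.prod_cons, Perm.coe_mul, ← Function.comp_assoc, h σ List.mem_cons_self,
      ih fun τ hτ => h τ (List.mem_cons_of_mem _ hτ)]

theorem comp_cutPerm_of_subset {α : Type*} [DecidableEq α] {C : Finset (Fin n)}
    {f : Fin (n + 1) → α} (h : cutSet f ⊆ C) : f ∘ cutPerm C = f := by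
  refine comp_list_prod f _ fun σ hσ => ?_
  simp only [List.mem_map, List.mem_filter, decide_eq_true_eq] at hσ
  obtain ⟨i, ⟨-, hi⟩, rfl⟩ := hσ
  have h1 : f i.castSucc = f i.succ := notMem_cutSet.1 fun hc => hi (h hc)
  ext j
  rw [Function.comp_apply, swap_apply_def]
  split_ifs with h2 h3
  · rw [h2, h1]
  · rw [h3, h1]
  · rfl

/-- The product applies the transpositions of largest index first. Those beyond `i` fix position
`i`, the one at `i` moves it one step on, and the remaining ones fix the new position. -/
theorem cutPerm_castSucc : ∀ C : Finset (Fin 5), ∀ i ∉ C, cutPerm C i.castSucc = i.succ := by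
  decide +kernel

theorem comp_cutPerm_iff {α : Type*} [DecidableEq α] {C : Finset (Fin 5)} {f : Fin 6 → α} :
    f ∘ cutPerm C = f ↔ cutSet f ⊆ C := by
  refine ⟨fun h i hi => ?_, comp_cutPerm_of_subset⟩
  by_contra hc
  refine notMem_cutSet.2 ?_ hi
  rw [← cutPerm_castSucc C i hc]
  exact (congrFun h i.castSucc).symm

/-- Both sides count the same words. On the diagonal, `C ∪ cutSet g = C` says that `g` is constant
on the blocks of `C`, which makes the monotonicity condition automatic. The words fixed by `cutPerm
C` are again those constant on the blocks. -/
theorem regCoeff_self (C : Finset (Fin 5)) (x : descentAlgebra F 6) :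
    regCoeff F C C x = evalCharacter F (cutPerm C) x := by
  induction x using cutBasis_induction with
  | h m b hb =>
    have h1 : evalCharacter F (cutPerm C) (cutBasis F 5 (cutSet b)) =
        (youngCharacter (ofCuts (cutSet b)) (cutPerm C) : F) := by
      rw [cutBasis, Module.Basis.reindex_apply]
      exact evalCharacter_descentBasis F _ _
    rw [regCoeff_cutBasis C C hb, h1, youngCharacter_eq _ hb
      (eq_iff_of_cutSet_eq (index_mono _) hb (cutSet_ofCuts _)), ← Finset.card_filter]
    congr 2
    refine Finset.filter_congr fun g _ => ?_
    rw [comp_cutPerm_iff, Finset.union_eq_left]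
    exact ⟨fun h => h.2, fun h => ⟨fun i hi => (notMem_cutSet.1 fun hc => hi (h hc)).le, h⟩⟩
  | hadd x y hx hy => rw [map_add, map_add, hx, hy]
  | hsmul a x hx => rw [map_smul, map_smul, hx]
  | h0 => rw [map_zero, map_zero]

theorem youngCharacter_eq_of_isConj {n : ℕ} {σ τ : Perm (Fin n)} (h : IsConj σ τ)
    (q : Composition n) : youngCharacter q σ = youngCharacter q τ := by
  obtain ⟨c, rfl⟩ := isConj_iff.1 h
  rw [youngCharacter_eq q (index_mono q) (fun _ _ => Iff.rfl),
    youngCharacter_eq q (index_mono q) (fun _ _ => Iff.rfl)]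
  refine Finset.sum_bij' (fun f _ => f ∘ ⇑c⁻¹) (fun f _ => f ∘ ⇑c) ?_ ?_ ?_ ?_ ?_
  · intro f hf; exact (rearr_comp _).2 hf
  · intro f hf; exact (rearr_comp _).2 hf
  · intro f hf; ext i; simp
  · intro f hf; ext i; simp
  · intro f hf
    have : f ∘ σ = f ↔ (f ∘ ⇑c⁻¹) ∘ ⇑(c * σ * c⁻¹) = f ∘ ⇑c⁻¹ := by
      constructor
      · intro e
        ext i
        simpa [perm_inv_apply] using congrArg Fin.val (congrFun e (c⁻¹ i))
      · intro e
        ext i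
        simpa [perm_inv_apply] using congrArg Fin.val (congrFun e (c i))
    simp only [this]

theorem evalCharacter_eq_of_partition {n : ℕ} {σ : Perm (Fin n)} {l : n.Partition}
    (h : σ.partition.parts = l.parts) : evalCharacter F σ = simpleCharacter F l := by
  have hp : σ.partition = (permOfPartition l).partition :=
    Nat.Partition.ext (h.trans (partition_permOfPartition l).symm)
  have hc : IsConj σ (permOfPartition l) := Perm.partition_eq_of_isConj.2 hp
  apply AlgHom.toLinearMap_injective
  refine (descentBasis F n).ext fun q => ?_
  change evalCharacter F σ _ = evalCharacter F (permOfPartition l) _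
  rw [evalCharacter_descentBasis, evalCharacter_descentBasis, youngCharacter_eq_of_isConj hc]

end Regular

/-! ### The partitions of `6` and the types of sets of cuts -/

/-- The parts of the partitions of `6`. -/
def vertexParts : Fin 11 → Multiset ℕ :=
  ![{6}, {5, 1}, {4, 2}, {3, 3}, {4, 1, 1}, {3, 2, 1}, {2, 2, 2}, {3, 1, 1, 1}, {2, 2, 1, 1},
    {2, 1, 1, 1, 1}, {1, 1, 1, 1, 1, 1}]

theorem vertexParts_pos : ∀ v, ∀ i ∈ vertexParts v, 0 < i := by decide +kernel

theorem vertexParts_sum : ∀ v, (vertexParts v).sum = 6 := by decide +kernel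

/-- The partitions of `6`. -/
def vertexPartition (v : Fin 11) : Nat.Partition 6 where
  parts := vertexParts v
  parts_pos := fun {_} h => vertexParts_pos v _ h
  parts_sum := vertexParts_sum v

/-- The block sizes of the composition of `6` with a given set of cuts. -/
def cutParts (C : Finset (Fin 5)) : List ℕ :=
  ((List.finRange 5).foldr (fun i s => if i ∈ C then (1, s.1 :: s.2) else (s.1 + 1, s.2))
    ((1, []) : ℕ × List ℕ)) |> fun s => s.1 :: s.2

/-- The number of the partition formed by the block sizes. -/
def cutType (C : Finset (Fin 5)) : Fin 11 :=
  ((List.finRange 11).find? fun v => vertexParts v = cutParts C).getD 0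

theorem partition_cutPerm :
    ∀ C : Finset (Fin 5), (cutPerm C).partition.parts = vertexParts (cutType C) := by
  decide +kernel

/-- The multisets of positive integers with a given sum, listed with repetitions. -/
def multisetsWithSum : ℕ → ℕ → List (Multiset ℕ)
  | 0, n => if n = 0 then [0] else []
  | k + 1, n => (if n = 0 then [0] else []) ++
      (List.range n).flatMap fun a => (multisetsWithSum k (n - (a + 1))).map ((a + 1) ::ₘ ·)

/-- This reduces the completeness of the list `vertexParts` to a finite check; `k` bounds the number
of parts. -/
theorem mem_multisetsWithSum (k n : ℕ) (s : Multiset ℕ) (hpos : ∀ i ∈ s, 0 < i)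
    (hsum : s.sum = n) (hk : s.card ≤ k) : s ∈ multisetsWithSum k n := by
  induction k generalizing n s with
  | zero =>
    rw [Nat.le_zero, Multiset.card_eq_zero] at hk
    subst hk
    rw [Multiset.sum_zero] at hsum
    simp [multisetsWithSum, ← hsum]
  | succ k ih =>
    induction s using Multiset.induction_on with
    | empty =>
      rw [Multiset.sum_zero] at hsum
      simp [multisetsWithSum, ← hsum]
    | cons a s _ =>
      have ha := hpos a (Multiset.mem_cons_self a s)
      rw [Multiset.sum_cons] at hsum
      rw [Multiset.card_cons] at hk
      refine List.mem_append_right _ (List.mem_flatMap.2 ⟨a - 1, ?_, ?_⟩)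
      · rw [List.mem_range]; omega
      · rw [Nat.sub_add_cancel ha]
        exact List.mem_map.2 ⟨s, ih _ s (fun i hi => hpos i (Multiset.mem_cons_of_mem hi))
          (by omega) (by omega), rfl⟩

theorem exists_vertexParts_eq : ∀ s ∈ multisetsWithSum 6 6, ∃ v, vertexParts v = s := by
  decide +kernel

theorem vertexParts_injective : Function.Injective vertexParts := by
  unfold Function.Injective
  decide +kernel

theorem vertexPartition_bijective : Function.Bijective vertexPartition := by
  refine ⟨fun v w h => vertexParts_injective (congrArg Nat.Partition.parts h), fun l => ?_⟩
  have hcard : l.parts.card ≤ 6 := by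
    have := Multiset.card_nsmul_le_sum (s := l.parts) (a := 1) fun x hx => l.parts_pos hx
    simpa [l.parts_sum] using this
  obtain ⟨v, hv⟩ := exists_vertexParts_eq _
    (mem_multisetsWithSum 6 6 l.parts (fun i hi => l.parts_pos hi) l.parts_sum hcard)
  exact ⟨v, Nat.Partition.ext hv⟩

/-- The character of the simple module labelled by the `v`-th partition. -/
def chi (F : Type*) [CommRing F] (v : Fin 11) : descentAlgebra F 6 →ₐ[F] F :=
  simpleCharacter F (vertexPartition v)

theorem regCoeff_self_eq_chi {F : Type*} [CommRing F] (C : Finset (Fin 5))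
    (x : descentAlgebra F 6) : regCoeff F C C x = chi F (cutType C) x := by
  rw [regCoeff_self, evalCharacter_eq_of_partition (l := vertexPartition (cutType C))
    (partition_cutPerm C)]
  rfl

/-! ### Two-letter words -/

/-- The word `0 ⋯ 0 1 ⋯ 1` with `k` ones. -/
def twoWord (k : ℕ) (i : Fin 6) : Bool := decide (6 ≤ i.val + k)

theorem monotone_twoWord (k : ℕ) : Monotone (twoWord k) := by
  intro i j hij
  rw [Bool.le_iff_imp]
  simp only [twoWord, decide_eq_true_eq]
  intro h
  have : (i : ℕ) ≤ j := hij
  omega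

theorem card_twoWord : ∀ k ≤ 6, #{i | twoWord k i = true} = k := by
  decide +kernel

theorem eq_twoWord : ∀ g : Fin 6 → Bool, (∀ i : Fin 5, g i.castSucc ≤ g i.succ) →
    ∀ i, g i = twoWord #{i | g i = true} i := by
  decide +kernel

/-- Sorting preserves the number of ones, and a weakly increasing word in two letters is determined
by that number. -/
theorem mem_rearr_twoWord {k : ℕ} (hk : k ≤ 6) {g : Fin 6 → Bool} :
    g ∈ rearr (twoWord k) ↔ #{i | g i = true} = k := by
  have h1 : #{i | (g ∘ Tuple.sort g) i = true} = #{i | g i = true} := by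
    refine Finset.card_bij' (fun i _ => Tuple.sort g i) (fun i _ => (Tuple.sort g)⁻¹ i) ?_ ?_ ?_ ?_
    all_goals simp
  rw [mem_rearr]
  constructor
  · intro h
    rw [← h1, h, card_twoWord k hk]
  · intro h
    ext i
    rw [eq_twoWord _ (fun i => Tuple.monotone_sort g (Fin.castSucc_lt_succ).le) i, h1, h]

/-- The number of two-letter words with `k` ones which increase weakly on the blocks of `C` and
cut `C` into `D`. -/
def cutCount (k : ℕ) (C D : Finset (Fin 5)) : ℕ :=
  #{g : Fin 6 → Bool | #{i | g i = true} = k ∧ (∀ i ∉ C, g i.castSucc ≤ g i.succ) ∧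
    C ∪ cutSet g = D}

/-! ### Matrix entries of the two-block elements and of their differences. -/

section Commutator

variable (F : Type*) [CommRing F]

theorem regCoeff_twoWord {k : ℕ} (hk : k ≤ 6) (C D : Finset (Fin 5)) :
    regCoeff F C D (cutBasis F 5 (cutSet (twoWord k))) = cutCount k C D := by
  rw [regCoeff_cutBasis C D (monotone_twoWord k), cutCount]
  congr 2
  ext g
  simp only [mem_filter, mem_univ, true_and, mem_rearr_twoWord hk]

/-- The difference `Ξ^(6-j,j) - Ξ^(j,6-j)`. -/
def commutator (j : ℕ) : descentAlgebra F 6 :=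
  cutBasis F 5 (cutSet (twoWord j)) - cutBasis F 5 (cutSet (twoWord (6 - j)))

/-- The entries of the commutators in the right regular representation. -/
def commutatorCoeff (j : ℕ) (C D : Finset (Fin 5)) : ℤ := cutCount j C D - cutCount (6 - j) C D

theorem regCoeff_commutator {j : ℕ} (hj : j ≤ 6) (C D : Finset (Fin 5)) :
    regCoeff F C D (commutator F j) = (commutatorCoeff j C D : F) := by
  rw [commutator, map_sub, regCoeff_twoWord F hj, regCoeff_twoWord F (Nat.sub_le 6 j),
    commutatorCoeff]
  push_cast
  rfl

/-- A set of cuts of a given type. -/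
def typeCut : Fin 11 → Finset (Fin 5) :=
  ![∅, {4}, {3}, {2}, {3, 4}, {2, 4}, {1, 3}, {2, 3, 4}, {1, 3, 4}, {1, 2, 3, 4}, univ]

theorem cutType_typeCut : ∀ v, cutType (typeCut v) = v := by decide +kernel

theorem chi_twoWord {k : ℕ} (hk : k ≤ 6) (v : Fin 11) :
    chi F v (cutBasis F 5 (cutSet (twoWord k))) = cutCount k (typeCut v) (typeCut v) := by
  rw [← regCoeff_twoWord F hk, regCoeff_self_eq_chi, cutType_typeCut]

/-- The two compositions differ only in the order of their blocks, so they have the same Young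
character. Only `j = 1` and `j = 2` are used for arrows. -/
theorem commutatorCoeff_typeCut :
    ∀ v, ∀ j ∈ ({1, 2} : Finset ℕ), commutatorCoeff j (typeCut v) (typeCut v) = 0 := by
  decide +kernel

theorem chi_commutator (v : Fin 11) {j : ℕ} (hj : j ∈ ({1, 2} : Finset ℕ)) :
    chi F v (commutator F j) = 0 := by
  have h6 : j ≤ 6 := by
    simp only [mem_insert, mem_singleton] at hj
    omega
  rw [← cutType_typeCut v, ← regCoeff_self_eq_chi, regCoeff_commutator F h6,
    commutatorCoeff_typeCut v j hj, Int.cast_zero]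

end Commutator

/-! ### The filtration by the number of cuts -/

section Depth

variable {n : ℕ} {F : Type*} [CommRing F]

/-- An element has depth at least `k` if right multiplication by it adds at least `k` cuts. -/
def HasDepth (k : ℕ) (x : descentAlgebra F (n + 1)) : Prop :=
  ∀ C D : Finset (Fin n), #D < #C + k → regCoeff F C D x = 0

theorem hasDepth_zero (x : descentAlgebra F (n + 1)) : HasDepth 0 x := fun _ _ h =>
  regCoeff_eq_zero (fun hs => (card_le_card hs).not_gt h) x

/-- An intermediate `E` with fewer than `i` new cuts is killed by `x`; one with more leaves fewer
than `j` cuts to be added and is killed by `y`. Leading entries thus multiply like matrices of a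
graded algebra. -/
theorem regCoeff_mul_of_hasDepth {i j : ℕ} {x y : descentAlgebra F (n + 1)} (hx : HasDepth i x)
    (hy : HasDepth j y) {C D : Finset (Fin n)} (h : #D ≤ #C + i + j) :
    regCoeff F C D (x * y) = ∑ E with #E = #C + i, regCoeff F C E x * regCoeff F E D y := by
  rw [regCoeff_mul]
  refine (Finset.sum_subset (filter_subset _ _) fun E _ hE => ?_).symm
  simp only [mem_filter, mem_univ, true_and] at hE
  rcases Nat.lt_or_gt_of_ne hE with h1 | h1
  · rw [hx C E h1, zero_mul]
  · rw [hy E D (by omega), mul_zero]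

theorem HasDepth.mul {i j : ℕ} {x y : descentAlgebra F (n + 1)} (hx : HasDepth i x)
    (hy : HasDepth j y) : HasDepth (i + j) (x * y) := by
  intro C D h
  rw [regCoeff_mul_of_hasDepth hx hy (by omega)]
  refine Finset.sum_eq_zero fun E hE => ?_
  simp only [mem_filter, mem_univ, true_and] at hE
  rw [hy E D (by omega), mul_zero]

theorem HasDepth.eq_zero {x : descentAlgebra F (n + 1)} (h : HasDepth (n + 1) x) : x = 0 :=
  eq_zero_of_regCoeff fun D => h ∅ D (by simpa using Nat.lt_succ_of_le (card_finset_fin_le D))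

theorem hasDepth_one_of_chi {x : descentAlgebra F 6} (h : ∀ v, chi F v x = 0) :
    HasDepth 1 x := by
  intro C D hD
  by_cases hs : C ⊆ D
  · rw [← eq_of_subset_of_card_le hs (by omega), regCoeff_self_eq_chi, h]
  · exact regCoeff_eq_zero hs x

/-- The matrix of `x` is strictly triangular, and no more than five cuts can be added. -/
theorem isNilpotent_of_chi {x : descentAlgebra F 6} (h : ∀ v, chi F v x = 0) :
    IsNilpotent x := by
  have hpow : ∀ k, HasDepth k (x ^ k) := by
    intro k
    induction k with
    | zero => exact hasDepth_zero _
    | succ k ih => rw [pow_succ]; exact ih.mul (hasDepth_one_of_chi h)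
  exact ⟨6, (hpow 6).eq_zero⟩

theorem hasDepth_one_commutator {j : ℕ} (hj : j ∈ ({1, 2} : Finset ℕ)) :
    HasDepth 1 (commutator F j) :=
  hasDepth_one_of_chi fun v => chi_commutator F v hj

end Depth

/-! ### Separation of the characters and idempotents -/

section Idempotents

/-- The diagonal entry counts the sets of blocks of total size `k`; the values for `k = 1, 2, 3`
tell the eleven partitions apart. The bound 6 keeps the differences nonzero modulo any prime from 7
on. -/
theorem cutCount_separates : ∀ v w : Fin 11, v ≠ w → ∃ k ∈ ({1, 2, 3} : Finset ℕ),
    (cutCount k (typeCut v) (typeCut v) : ℤ) - cutCount k (typeCut w) (typeCut w) ≠ 0 ∧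
    ((cutCount k (typeCut v) (typeCut v) : ℤ) - cutCount k (typeCut w) (typeCut w)).natAbs ≤ 6 := by
  decide +kernel

variable {F : Type*} [Field F] {p : ℕ} [CharP F p]


theorem intCast_ne_zero (hp : p = 0 ∨ 7 ≤ p) {d : ℤ} (hd : d ≠ 0) (h6 : d.natAbs ≤ 6) :
    (d : F) ≠ 0 := by
  rw [Ne, CharP.intCast_eq_zero_iff F p]
  intro h
  have h1 := Int.natAbs_dvd_natAbs.2 h
  rw [Int.natAbs_natCast] at h1
  have h2 := Nat.le_of_dvd (Int.natAbs_pos.2 hd) h1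
  rcases hp with rfl | hp
  · exact hd (Int.natAbs_eq_zero.1 (Nat.zero_dvd.1 h1))
  · omega


theorem exists_chi_ne (hp : p = 0 ∨ 7 ≤ p) {v w : Fin 11} (h : v ≠ w) :
    ∃ x, chi F v x ≠ chi F w x := by
  obtain ⟨k, hk, h1, h2⟩ := cutCount_separates v w h
  have h6 : k ≤ 6 := by
    simp only [mem_insert, mem_singleton] at hk
    omega
  refine ⟨cutBasis F 5 (cutSet (twoWord k)), sub_ne_zero.1 ?_⟩
  rw [chi_twoWord F h6, chi_twoWord F h6]
  exact_mod_cast intCast_ne_zero (F := F) hp h1 h2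

/-- Finitely many distinct characters take arbitrary values simultaneously. -/
theorem exists_eval_eq_ite {ι A : Type*} [Fintype ι] [DecidableEq ι] [Ring A] [Algebra F A]
    (χ : ι → A →ₐ[F] F) (h : ∀ v w, v ≠ w → ∃ x, χ v x ≠ χ w x) (v : ι) :
    ∃ z, ∀ w, χ w z = if w = v then 1 else 0 := by
  choose! x hx using h v
  -- Lagrange interpolation: the factor for `w` takes the value 1 under `χ v` and 0 under `χ w`.
  let y : ι → A := fun w => (χ v (x w) - χ w (x w))⁻¹ • (x w - algebraMap F A (χ w (x w)))
  refine ⟨((univ.erase v).toList.map y).prod, fun w => ?_⟩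
  rw [map_list_prod, List.map_map]
  split_ifs with hw
  · subst hw
    refine List.prod_eq_one fun t ht => ?_
    simp only [List.mem_map, mem_toList, mem_erase, mem_univ, and_true] at ht
    obtain ⟨u, hu, rfl⟩ := ht
    have := sub_ne_zero.2 (hx u (Ne.symm hu))
    simp [y, this]
  · refine List.prod_eq_zero (List.mem_map.2 ⟨w, by simpa using hw, ?_⟩)
    simp [y]


/-- The characters together map the algebra to `F^11`. The kernel is nil and interpolation reaches
the coordinate idempotents, so these lift. -/
theorem exists_idempotents (hp : p = 0 ∨ 7 ≤ p) : ∃ e : Fin 11 → descentAlgebra F 6,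
    CompleteOrthogonalIdempotents e ∧ ∀ v w, chi F w (e v) = if w = v then 1 else 0 := by
  let f : descentAlgebra F 6 →+* (Fin 11 → F) := RingHom.pi fun v => (chi F v : _ →+* F)
  obtain ⟨e, he, hf⟩ := CompleteOrthogonalIdempotents.lift_of_isNilpotent_ker f
    (fun x hx => isNilpotent_of_chi fun v => congrFun hx v)
    (CompleteOrthogonalIdempotents.single fun _ : Fin 11 => F) fun v => by
      obtain ⟨z, hz⟩ := exists_eval_eq_ite (chi F) (fun v w => exists_chi_ne hp) v
      refine ⟨z, funext fun w => ?_⟩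
      rw [Pi.single_apply]
      exact hz w
  refine ⟨e, he, fun v w => ?_⟩
  have h := congrFun (congrFun hf v) w
  rw [Pi.single_apply] at h
  exact h

end Idempotents

/-! ### Products along paths -/

/-- The number of the commutator used for an arrow. -/
def arrowIndex (b c : Fin 11) : ℕ := if (b, c) = (2, 0) ∨ (b, c) = (5, 1) then 2 else 1

/-- The leading coefficients of the product along a path, listed from its target to its source. -/
def pathCoeff : List (Fin 11) → Finset (Fin 5) → Finset (Fin 5) → ℤ
  | [], _, _ => 0
  | [v], C, D => if C = D ∧ cutType C = v then 1 else 0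
  | c :: b :: l, C, D => if cutType C = c then
      ∑ E with #E = #C + 1 ∧ cutType E = b,
        commutatorCoeff (arrowIndex b c) C E * pathCoeff (b :: l) E D else 0

/-- The paths, apart from `2²1² → 321 → 51 → 6`, listed from their target to their source. -/
def stdPaths : Finset (List (Fin 11)) :=
  {[0], [1], [2], [3], [4], [5], [6], [7], [8], [9], [10],
   [0, 1], [0, 2], [1, 4], [1, 5], [2, 5], [3, 5], [4, 7], [5, 8], [7, 9],
   [0, 1, 4], [0, 1, 5], [0, 2, 5], [1, 4, 7], [1, 5, 8], [2, 5, 8], [3, 5, 8], [4, 7, 9],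
   [0, 1, 4, 7], [0, 2, 5, 8], [1, 4, 7, 9], [0, 1, 4, 7, 9]}

theorem card_stdPaths : #stdPaths = 32 := by decide +kernel

/-- A list of `m` vertices has `m - 1` arrows, each of which adds one cut in the leading entry;
hence the size of `D`. Two standard paths with the same ends have the same length, so both entries
at `D` are leading ones. The only such pair consists of the two paths from `321` to `6`. The bound 6
ensures that the entry survives in characteristic at least 7. -/
theorem pathCoeff_separates : ∀ l ∈ stdPaths, ∃ D,
    #D + 1 = #(typeCut (l.headD 0)) + l.length ∧
    pathCoeff l (typeCut (l.headD 0)) D ≠ 0 ∧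
    (pathCoeff l (typeCut (l.headD 0)) D).natAbs ≤ 6 ∧
    ∀ l' ∈ stdPaths, l'.headD 0 = l.headD 0 → l'.getLastD 0 = l.getLastD 0 → l' ≠ l →
      l'.length = l.length ∧ pathCoeff l' (typeCut (l.headD 0)) D = 0 := by
  decide +kernel

theorem arrowIndex_mem (b c : Fin 11) : arrowIndex b c ∈ ({1, 2} : Finset ℕ) := by
  unfold arrowIndex
  split_ifs <;> simp

theorem arrowIndex_le (b c : Fin 11) : arrowIndex b c ≤ 6 := by
  unfold arrowIndex
  split_ifs <;> simp

section PathProd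

variable {F : Type*} [Field F]

/-- A complete family of orthogonal idempotents dual to the simple characters. -/
structure IsDualFamily (e : Fin 11 → descentAlgebra F 6) : Prop where
  complete : CompleteOrthogonalIdempotents e
  chi_apply : ∀ v w, chi F w (e v) = if w = v then 1 else 0

/-- The element representing an arrow from `b` to `c`. -/
def arrow (e : Fin 11 → descentAlgebra F 6) (b c : Fin 11) : descentAlgebra F 6 :=
  e c * commutator F (arrowIndex b c) * e b

/-- The product along a path, listed from its target to its source. -/
def pathProd (e : Fin 11 → descentAlgebra F 6) : List (Fin 11) → descentAlgebra F 6
  | [] => 0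
  | [v] => e v
  | c :: b :: l => arrow e b c * pathProd e (b :: l)

variable {e : Fin 11 → descentAlgebra F 6}

theorem hasDepth_one_arrow (b c : Fin 11) : HasDepth 1 (arrow e b c) := by
  have h := ((hasDepth_zero (e c)).mul (hasDepth_one_commutator (F := F)
    (arrowIndex_mem b c))).mul (hasDepth_zero (e b))
  rw [zero_add, add_zero] at h
  exact h

theorem hasDepth_pathProd (l : List (Fin 11)) : HasDepth (l.length - 1) (pathProd e l) := by
  induction l with
  | nil => exact hasDepth_zero _
  | cons c l ih =>
    cases l with
    | nil => exact hasDepth_zero _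
    | cons b l =>
      have h := (hasDepth_one_arrow (e := e) b c).mul ih
      rw [show 1 + ((b :: l).length - 1) = (c :: b :: l).length - 1 by simp [add_comm]] at h
      exact h

namespace IsDualFamily

variable (he : IsDualFamily e)

include he

theorem regCoeff_apply {C D : Finset (Fin 5)} (h : #D = #C) (v : Fin 11) :
    regCoeff F C D (e v) = if C = D ∧ cutType C = v then 1 else 0 := by
  by_cases hCD : C = D
  · subst hCD
    simp [regCoeff_self_eq_chi, he.chi_apply]
  · rw [if_neg fun h' => hCD h'.1]
    exact regCoeff_eq_zero (fun hs => hCD (eq_of_subset_of_card_le hs h.le)) _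

/-- In leading degree only the diagonal of `e v` matters, and there it is the projection to the sets
of cuts of type `v`. This is why the choice of lifts has no influence. -/
theorem regCoeff_mul_apply {k : ℕ} {x : descentAlgebra F 6} (hx : HasDepth k x)
    {C D : Finset (Fin 5)} (h : #D = #C + k) (v : Fin 11) :
    regCoeff F C D (x * e v) = if cutType D = v then regCoeff F C D x else 0 := by
  rw [regCoeff_mul_of_hasDepth hx (hasDepth_zero _) (by omega), Finset.sum_eq_single D]
  · rw [he.regCoeff_apply rfl]
    simp
  · intro E hE hED
    rw [mem_filter] at hE
    rw [he.regCoeff_apply (by omega), if_neg fun h' => hED h'.1, mul_zero]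
  · intro hD
    simp [h] at hD

theorem regCoeff_apply_mul {k : ℕ} {x : descentAlgebra F 6} (hx : HasDepth k x)
    {C D : Finset (Fin 5)} (h : #D = #C + k) (v : Fin 11) :
    regCoeff F C D (e v * x) = if cutType C = v then regCoeff F C D x else 0 := by
  rw [regCoeff_mul_of_hasDepth (hasDepth_zero _) hx (by omega), Finset.sum_eq_single C]
  · rw [he.regCoeff_apply rfl]
    simp
  · intro E hE hED
    rw [mem_filter] at hE
    rw [he.regCoeff_apply (by omega), if_neg fun h' => hED h'.1.symm, zero_mul]
  · intro hD
    simp at hD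

theorem regCoeff_arrow {C D : Finset (Fin 5)} (h : #D = #C + 1) (b c : Fin 11) :
    regCoeff F C D (arrow e b c) =
      if cutType C = c ∧ cutType D = b then (commutatorCoeff (arrowIndex b c) C D : F) else 0 := by
  have h1 := hasDepth_one_commutator (F := F) (arrowIndex_mem b c)
  have h2 := (hasDepth_zero (e c)).mul h1
  rw [zero_add] at h2
  rw [arrow, he.regCoeff_mul_apply h2 h, he.regCoeff_apply_mul h1 h,
    regCoeff_commutator F (arrowIndex_le b c)]
  split_ifs <;> first | rfl | tauto

/-- The depth bounds leave only chains of sets of cuts that gain one cut at each arrow, and the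
idempotents prescribe the type of each member. The sum over these chains is `pathCoeff`. -/
theorem regCoeff_pathProd {l : List (Fin 11)} (hl : l ≠ []) {C D : Finset (Fin 5)}
    (h : #D + 1 = #C + l.length) :
    regCoeff F C D (pathProd e l) = (pathCoeff l C D : F) := by
  induction l generalizing C D with
  | nil => exact absurd rfl hl
  | cons c l ih =>
    cases l with
    | nil =>
      simp only [List.length_singleton] at h
      rw [pathProd, pathCoeff, he.regCoeff_apply (by omega)]
      split_ifs <;> simp
    | cons b l =>
      have hd := hasDepth_pathProd (e := e) (b :: l)
      simp only [List.length_cons] at h hd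
      rw [pathProd, pathCoeff, regCoeff_mul_of_hasDepth (hasDepth_one_arrow b c) hd (by omega)]
      have hsum : ∀ E ∈ ({E | #E = #C + 1} : Finset (Finset (Fin 5))),
          regCoeff F C E (arrow e b c) * regCoeff F E D (pathProd e (b :: l)) =
          if cutType C = c then if cutType E = b then
            ((commutatorCoeff (arrowIndex b c) C E * pathCoeff (b :: l) E D : ℤ) : F)
            else 0 else 0 := by
        intro E hE
        simp only [mem_filter, mem_univ, true_and] at hE
        rw [he.regCoeff_arrow hE, ih (List.cons_ne_nil _ _) (by simp; omega)]
        split_ifs <;> first | (push_cast; rfl) | tauto | simp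
      rw [Finset.sum_congr rfl hsum]
      split_ifs with hc
      · rw [← Finset.sum_filter, Finset.filter_filter]
        push_cast
        rfl
      · simp

theorem mul_self (v : Fin 11) : e v * e v = e v := he.complete.idem v

theorem mul_ne {v w : Fin 11} (h : v ≠ w) : e v * e w = 0 := he.complete.ortho h

theorem mul_pathProd_cons (v c : Fin 11) (l : List (Fin 11)) :
    e v * pathProd e (c :: l) = if c = v then pathProd e (c :: l) else 0 := by
  have key : e c * pathProd e (c :: l) = pathProd e (c :: l) := by
    cases l with
    | nil => exact he.mul_self c
    | cons b l => simp only [pathProd, arrow, ← mul_assoc, he.mul_self]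
  split_ifs with h
  · rw [← h, key]
  · rw [← key, ← mul_assoc, he.mul_ne (Ne.symm h), zero_mul]

theorem pathProd_mul {l : List (Fin 11)} (hl : l ≠ []) (v : Fin 11) :
    pathProd e l * e v = if l.getLastD 0 = v then pathProd e l else 0 := by
  induction l with
  | nil => exact absurd rfl hl
  | cons c l ih =>
    cases l with
    | nil =>
      simp only [pathProd, List.getLastD_cons, List.getLastD_nil]
      split_ifs with h
      · rw [h, he.mul_self]
      · exact he.mul_ne h
    | cons b l =>
      rw [pathProd, mul_assoc, ih (List.cons_ne_nil _ _)]
      simp only [List.getLastD_cons]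
      split_ifs <;> simp

theorem mul_pathProd {l : List (Fin 11)} (hl : l ≠ []) (v : Fin 11) :
    e v * pathProd e l = if l.headD 0 = v then pathProd e l else 0 := by
  cases l with
  | nil => exact absurd rfl hl
  | cons c l => exact he.mul_pathProd_cons v c l

theorem mul_pathProd_mul {l : List (Fin 11)} (hl : l ≠ []) (v w : Fin 11) :
    e v * pathProd e l * e w =
      if l.headD 0 = v ∧ l.getLastD 0 = w then pathProd e l else 0 := by
  rw [he.mul_pathProd hl]
  split_ifs with h1 h2 h2
  · rw [he.pathProd_mul hl, if_pos h2.2]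
  · rw [he.pathProd_mul hl, if_neg fun h => h2 ⟨h1, h⟩]
  · exact absurd h2.1 h1
  · rw [zero_mul]

end IsDualFamily

theorem ne_nil_of_mem_stdPaths : ∀ l ∈ stdPaths, l ≠ [] := by decide +kernel

variable {p : ℕ} [CharP F p]

theorem IsDualFamily.linearIndependent (he : IsDualFamily e) (hp : p = 0 ∨ 7 ≤ p) :
    LinearIndependent F fun l : stdPaths => pathProd e l.1 := by
  rw [Fintype.linearIndependent_iff]
  rintro g hg ⟨l, hl⟩
  obtain ⟨D, hD, h0, h6, hsep⟩ := pathCoeff_separates l hl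
  have hne := ne_nil_of_mem_stdPaths
  -- Multiplying by the idempotents at the two ends of `l` removes all paths with other ends; the
  -- entry at `D` then singles out `l`.
  have h1 := congrArg (fun x => regCoeff F (typeCut (l.headD 0)) D
    (e (l.headD 0) * x * e (l.getLastD 0))) hg
  simp only [Finset.mul_sum, Finset.sum_mul, mul_smul_comm, smul_mul_assoc, map_sum, map_smul,
    mul_zero, zero_mul, map_zero, smul_eq_mul] at h1
  rw [Finset.sum_eq_single ⟨l, hl⟩] at h1
  · rw [he.mul_pathProd_mul (hne l hl), if_pos ⟨rfl, rfl⟩, he.regCoeff_pathProd (hne l hl) hD] at h1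
    exact (mul_eq_zero.1 h1).resolve_right (intCast_ne_zero hp h0 h6)
  · rintro ⟨l', hl'⟩ _ hll
    rw [he.mul_pathProd_mul (hne l' hl')]
    split_ifs with h
    · obtain ⟨hlen, hz⟩ := hsep l' hl' h.1 h.2 fun h => hll (Subtype.ext h)
      rw [he.regCoeff_pathProd (hne l' hl') (by omega), hz, Int.cast_zero, mul_zero]
    · rw [map_zero, mul_zero]
  · intro h
    exact absurd (mem_univ _) h

instance : Nonempty stdPaths := ⟨[0], by decide +kernel⟩

/-- The basis of the descent algebra consisting of the products along the standard paths. -/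
def IsDualFamily.basis (he : IsDualFamily e) (hp : p = 0 ∨ 7 ≤ p) :
    Module.Basis stdPaths F (descentAlgebra F 6) :=
  basisOfLinearIndependentOfCardEqFinrank (he.linearIndependent hp) (by
    rw [Fintype.card_coe, card_stdPaths, Module.finrank_eq_card_basis (cutBasis F 5)]
    rfl)

theorem IsDualFamily.basis_apply (he : IsDualFamily e) (hp : p = 0 ∨ 7 ≤ p) (l : stdPaths) :
    he.basis hp l = pathProd e l.1 := by
  rw [IsDualFamily.basis, coe_basisOfLinearIndependentOfCardEqFinrank]

end PathProd

/-! ### Extensions of one-dimensional modules -/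

section Ext

open CategoryTheory

/-- `Ext¹` from a presentation with projective middle term: it is the space of morphisms from the
kernel modulo those that extend. -/
theorem finrank_ext_one_eq {F C W : Type*} [Field F] [Category C] [Abelian C] [Linear F C]
    [HasExt C] {S : ShortComplex C} (hS : S.ShortExact) [Projective S.X₂] (Y : C)
    [AddCommGroup W] [Module F W] (ev : (S.X₁ ⟶ Y) →ₗ[F] W) (hsurj : Function.Surjective ev)
    (hker : ∀ φ, ev φ = 0 ↔ ∃ ψ : S.X₂ ⟶ Y, S.f ≫ ψ = φ) :
    Module.finrank F (Abelian.Ext S.X₃ Y 1) = Module.finrank F W := by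
  -- This is the connecting homomorphism. It is surjective because `Ext¹` vanishes on the projective
  -- `S.X₂`, and its kernel consists of the morphisms that extend. Hence it has the same kernel as
  -- `ev`, and the two targets are the same quotient.
  let δ : (S.X₁ ⟶ Y) →ₗ[F] Abelian.Ext S.X₃ Y 1 :=
    (hS.extClass.precompOfLinear F Y (a := 0) (b := 1) (by norm_num)) ∘ₗ
      (Abelian.Ext.linearEquiv₀ (R := F)).symm.toLinearMap
  have hδ : ∀ φ, δ φ = hS.extClass.comp (Abelian.Ext.mk₀ φ) (by norm_num) := fun _ => rfl
  have hδs : Function.Surjective δ := by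
    intro x
    obtain ⟨y, hy⟩ := Abelian.Ext.contravariant_sequence_exact₃ hS Y x
      (Abelian.Ext.eq_zero_of_projective _) (n₀ := 0) (by norm_num)
    refine ⟨Abelian.Ext.linearEquiv₀ (R := F) y, ?_⟩
    rw [hδ, Abelian.Ext.mk₀_linearEquiv₀_apply, hy]
  have hδk : LinearMap.ker δ = LinearMap.ker ev := by
    ext φ
    rw [LinearMap.mem_ker, LinearMap.mem_ker, hker, hδ]
    constructor
    · intro h
      obtain ⟨y, hy⟩ := Abelian.Ext.contravariant_sequence_exact₁ hS Y _ _ h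
      refine ⟨Abelian.Ext.linearEquiv₀ (R := F) y, ?_⟩
      apply (Abelian.Ext.mk₀_bijective S.X₁ Y).1
      rw [← Abelian.Ext.mk₀_comp_mk₀, Abelian.Ext.mk₀_linearEquiv₀_apply, hy]
    · rintro ⟨ψ, rfl⟩
      rw [← Abelian.Ext.mk₀_comp_mk₀, hS.extClass_comp_assoc]
  rw [← (δ.quotKerEquivOfSurjective hδs).finrank_eq, hδk,
    (ev.quotKerEquivOfSurjective hsurj).finrank_eq]

/-- The one-dimensional module given by a character of an algebra. -/
def CharModule {F A : Type*} [Field F] [Ring A] [Algebra F A] (_ : A →ₐ[F] F) : Type _ := F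

variable {F A : Type*} [Field F] [Ring A] [Algebra F A]

/-- An element of a one-dimensional module as a scalar. -/
def CharModule.val {χ : A →ₐ[F] F} (x : CharModule χ) : F := x

instance (χ : A →ₐ[F] F) : AddCommGroup (CharModule χ) := inferInstanceAs (AddCommGroup F)

instance (χ : A →ₐ[F] F) : Module A (CharModule χ) := Module.compHom F χ.toRingHom

/-- A character as a module homomorphism. -/
def toCharModule (χ : A →ₐ[F] F) : A →ₗ[A] CharModule χ where
  toFun := χ
  map_add' := map_add χ
  map_smul' := map_mul χ

theorem mem_ker_toCharModule {χ : A →ₐ[F] F} {x : A} :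
    x ∈ LinearMap.ker (toCharModule χ) ↔ χ x = 0 := Iff.rfl

/-- Homomorphisms of left modules from a left ideal to a one-dimensional module. -/
def CharModule.homOfLinear (ψ : A →ₐ[F] F) (K : Submodule A A) (d : A →ₗ[F] F)
    (hd : ∀ x, ∀ y ∈ K, d (x * y) = ψ x * d y) : K →ₗ[A] CharModule ψ where
  toFun y := d y
  map_add' y z := d.map_add y z
  map_smul' x y := hd x y y.2

theorem CharModule.hom_mul {ψ : A →ₐ[F] F} {K : Submodule A A} (φ : K →ₗ[A] CharModule ψ)
    (x : A) (y : K) : (φ (x • y)).val = ψ x * (φ y).val := φ.map_smul x y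

end Ext

/-! ### `Ext¹` between one-dimensional modules, computed from the kernel of a character. -/

section ExtChar

open CategoryTheory

universe u

variable {F A : Type u} [Field F] [Ring A] [Algebra F A]

/-- The presentation of a one-dimensional module as a quotient of the algebra. -/
abbrev charPresentation (χ : A →ₐ[F] F) : ShortComplex (ModuleCat.{u} A) :=
  ShortComplex.mk (ModuleCat.ofHom (LinearMap.ker (toCharModule χ)).subtype)
    (ModuleCat.ofHom (toCharModule χ)) (ModuleCat.hom_ext (LinearMap.ext fun x => x.2))

theorem charPresentation_shortExact (χ : A →ₐ[F] F) : (charPresentation χ).ShortExact := by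
  refine ShortComplex.ShortExact.mk' ?_ ?_ ?_
  · rw [ShortComplex.moduleCat_exact_iff]
    intro x hx
    exact ⟨⟨x, hx⟩, rfl⟩
  · rw [ModuleCat.mono_iff_injective]
    exact Subtype.val_injective
  · rw [ModuleCat.epi_iff_surjective]
    intro a
    exact ⟨algebraMap F A a, χ.commutes a⟩

/-- Evaluation of morphisms to a one-dimensional module. -/
def evalHom (ψ : A →ₐ[F] F) {K : ModuleCat.{u} A} (x : K) :
    (K ⟶ ModuleCat.of A (CharModule ψ)) →ₗ[F] F where
  toFun φ := φ.hom x
  map_add' _ _ := rfl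
  map_smul' r φ := by
    change ψ (algebraMap F A r) * _ = _
    rw [AlgHom.commutes]
    rfl

instance (χ : A →ₐ[F] F) : Projective (charPresentation χ).X₂ :=
  (IsProjective.iff_projective A).1 inferInstance

/-- If every semilinear form on `ker χ` extends to the algebra, then `Ext¹` vanishes. -/
theorem finrank_ext_charModule_eq_zero (χ ψ : A →ₐ[F] F)
    (h : ∀ φ : LinearMap.ker (toCharModule χ) →ₗ[A] CharModule ψ,
      ∃ c : F, ∀ x, (φ x).val = ψ x * c) :
    Module.finrank F (Abelian.Ext (ModuleCat.of A (CharModule χ))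
      (ModuleCat.of A (CharModule ψ)) 1) = 0 := by
  refine (finrank_ext_one_eq (charPresentation_shortExact χ) _ (0 : _ →ₗ[F] PUnit.{u + 1})
    (fun _ => ⟨0, rfl⟩) fun φ => ⟨fun _ => ?_, fun _ => rfl⟩).trans
    Module.finrank_zero_of_subsingleton
  obtain ⟨c, hc⟩ := h φ.hom
  refine ⟨ModuleCat.ofHom (LinearMap.toSpanSingleton A (CharModule ψ) c), ?_⟩
  ext x
  exact (hc x).symm

/-- If the semilinear forms on `ker χ` that extend to the algebra are the forms vanishing at `a`,
and not all forms do, then `Ext¹` is one-dimensional. -/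
theorem finrank_ext_charModule_eq_one (χ ψ : A →ₐ[F] F)
    (a : LinearMap.ker (toCharModule χ)) (ha : ψ a = 0)
    (h : ∀ φ : LinearMap.ker (toCharModule χ) →ₗ[A] CharModule ψ, (φ a).val = 0 →
      ∃ c : F, ∀ x, (φ x).val = ψ x * c)
    (φ₀ : LinearMap.ker (toCharModule χ) →ₗ[A] CharModule ψ) (h₀ : (φ₀ a).val ≠ 0) :
    Module.finrank F (Abelian.Ext (ModuleCat.of A (CharModule χ))
      (ModuleCat.of A (CharModule ψ)) 1) = 1 := by
  let S := charPresentation χ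
  refine (finrank_ext_one_eq (charPresentation_shortExact χ) _
    (evalHom ψ (K := S.X₁) a) ?_ fun φ => ⟨fun hφ => ?_, ?_⟩).trans (Module.finrank_self F)
  · refine LinearMap.surjective fun h0 => h₀ ?_
    exact LinearMap.congr_fun h0 (ModuleCat.ofHom φ₀)
  · obtain ⟨c, hc⟩ := h φ.hom hφ
    refine ⟨ModuleCat.ofHom (LinearMap.toSpanSingleton A (CharModule ψ) c), ?_⟩
    ext x
    exact (hc x).symm
  · rintro ⟨θ, rfl⟩
    let f : A →ₗ[A] CharModule ψ := θ.hom
    change (f a).val = 0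
    -- A form on the whole algebra is determined by its value at 1, so it vanishes wherever `ψ`
    -- does.
    have h1 : (f ((a : A) • (1 : A))).val = ψ a * (f 1).val := f.map_smul (a : A) 1
    rwa [smul_eq_mul, mul_one, ha, zero_mul] at h1

theorem extDim_eq (l m : Nat.Partition 6) :
    extDim F l m = Module.finrank F (Abelian.Ext
      (ModuleCat.of (descentAlgebra F 6) (CharModule (simpleCharacter F l)))
      (ModuleCat.of (descentAlgebra F 6) (CharModule (simpleCharacter F m))) 1) := rfl

end ExtChar

/-! ### The Ext quiver of the descent algebra -/

section ExtQuiver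

variable {F : Type*} [Field F] {e : Fin 11 → descentAlgebra F 6}

theorem chi_pathProd {l : List (Fin 11)} (hl : 2 ≤ l.length) (v : Fin 11) :
    chi F v (pathProd e l) = 0 := by
  match l, hl with
  | c :: b :: l, _ =>
    rw [pathProd, arrow, map_mul, map_mul, map_mul, chi_commutator F v (arrowIndex_mem b c)]
    simp

theorem chi_arrow (v b c : Fin 11) : chi F v (arrow e b c) = 0 := by
  rw [arrow, map_mul, map_mul, chi_commutator F v (arrowIndex_mem b c)]
  simp

theorem arrow_mem_ker (b c : Fin 11) :
    arrow e b c ∈ LinearMap.ker (toCharModule (chi F b)) :=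
  mem_ker_toCharModule.2 (chi_arrow b b c)

namespace IsDualFamily

variable (he : IsDualFamily e)

include he

theorem arrow_mul (b c : Fin 11) : arrow e b c * e b = arrow e b c := by
  rw [arrow, mul_assoc, he.mul_self]

theorem mul_arrow (b c : Fin 11) : e c * arrow e b c = arrow e b c := by
  rw [arrow, ← mul_assoc, ← mul_assoc, he.mul_self]

theorem sub_mem_ker (b : Fin 11) (x : descentAlgebra F 6) :
    x - algebraMap F _ (chi F b x) * e b ∈ LinearMap.ker (toCharModule (chi F b)) := by
  rw [mem_ker_toCharModule, map_sub, map_mul, AlgHom.commutes, he.chi_apply]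
  simp

theorem mem_ker_of_ne {v b : Fin 11} (h : v ≠ b) :
    e v ∈ LinearMap.ker (toCharModule (chi F b)) := by
  rw [mem_ker_toCharModule, he.chi_apply, if_neg (Ne.symm h)]

variable {p : ℕ} [CharP F p]

/-- The form is tested on the basis of path products. On a product of two elements killed by both
characters it vanishes, which disposes of paths of length at least 2. The idempotents dispose of
every arrow except the one from `b` to `c`, where `hφ` applies. Only the value at `e c` remains. -/
theorem semilinear_eq (hp : p = 0 ∨ 7 ≤ p) {b c : Fin 11}
    (φ : LinearMap.ker (toCharModule (chi F b)) →ₗ[descentAlgebra F 6] CharModule (chi F c))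
    (hφ : [c, b] ∈ stdPaths → (φ ⟨arrow e b c, arrow_mem_ker b c⟩).val = 0) :
    ∃ k : F, ∀ x, (φ x).val = chi F c x * k := by
  have hmul : ∀ (x y : descentAlgebra F 6) (hy : y ∈ LinearMap.ker (toCharModule (chi F b)))
      (hxy : x * y ∈ LinearMap.ker (toCharModule (chi F b))),
      (φ ⟨x * y, hxy⟩).val = chi F c x * (φ ⟨y, hy⟩).val := fun x y hy _ =>
    CharModule.hom_mul φ x ⟨y, hy⟩
  -- For `c = b` the idempotent `e c` is not in the kernel; there `chi F c` vanishes on the kernel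
  -- and any `k` will do.
  obtain ⟨k, hk⟩ : ∃ k : F, ∀ h : c ≠ b, (φ ⟨e c, he.mem_ker_of_ne h⟩).val = k := by
    by_cases h : c ≠ b
    · exact ⟨(φ ⟨e c, he.mem_ker_of_ne h⟩).val, fun _ => rfl⟩
    · exact ⟨0, fun h' => absurd h' h⟩
  -- The form is extended linearly to the whole algebra by projecting along `e b`, so that it can be
  -- compared on a basis.
  let f : descentAlgebra F 6 →ₗ[F] F :=
    { toFun := fun x => (φ ⟨_, he.sub_mem_ker b x⟩).val
      map_add' := fun x y => by
        have h : (⟨_, he.sub_mem_ker b (x + y)⟩ : LinearMap.ker (toCharModule (chi F b))) =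
            ⟨_, he.sub_mem_ker b x⟩ + ⟨_, he.sub_mem_ker b y⟩ := by
          apply Subtype.ext
          change _ = _ + _
          dsimp only
          rw [map_add, map_add, add_mul]
          abel
        rw [h, map_add]
        rfl
      map_smul' := fun r x => by
        have h : r • x - algebraMap F _ (chi F b (r • x)) * e b =
            algebraMap F _ r * (x - algebraMap F _ (chi F b x) * e b) := by
          rw [map_smul, smul_eq_mul, map_mul, mul_sub, mul_assoc, Algebra.smul_def]
        have h' : algebraMap F _ r * (x - algebraMap F _ (chi F b x) * e b) ∈
            LinearMap.ker (toCharModule (chi F b)) := h ▸ he.sub_mem_ker b (r • x)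
        have h1 := hmul (algebraMap F _ r) _ (he.sub_mem_ker b x) h'
        rw [AlgHom.commutes] at h1
        exact (congrArg (fun y => (φ y).val) (Subtype.ext h)).trans h1 }
  have hf : ∀ x (hx : x ∈ LinearMap.ker (toCharModule (chi F b))), f x = (φ ⟨x, hx⟩).val := by
    intro x hx
    refine congrArg (fun y => (φ y).val) (Subtype.ext ?_)
    dsimp only
    rw [mem_ker_toCharModule.1 hx, map_zero, zero_mul, sub_zero]
  have hfb : f (e b) = 0 := by
    have : (⟨_, he.sub_mem_ker b (e b)⟩ : LinearMap.ker (toCharModule (chi F b))) = 0 := by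
      apply Subtype.ext
      dsimp only
      rw [he.chi_apply, if_pos rfl, map_one, one_mul, sub_self]
      rfl
    change (φ ⟨_, he.sub_mem_ker b (e b)⟩).val = 0
    rw [this, map_zero]
    rfl
  have hfmul : ∀ x y, chi F b y = 0 → f (x * y) = chi F c x * f y := by
    intro x y hy
    have hxy : chi F b (x * y) = 0 := by rw [map_mul, hy, mul_zero]
    rw [hf y hy, hf (x * y) hxy]
    exact hmul x y hy hxy
  -- The right-hand side vanishes on the kernel of `chi F b`. It only corrects the value at `e b` in
  -- the case `b = c`, because `f (e b) = 0`.
  have key : f - (chi F c).toLinearMap.smulRight k =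
      -(chi F b).toLinearMap.smulRight (chi F c (e b) * k) := by
    refine (he.basis hp).ext fun l => ?_
    rw [he.basis_apply hp]
    obtain ⟨l, hl⟩ := l
    simp only [LinearMap.sub_apply, LinearMap.neg_apply, LinearMap.smulRight_apply,
      AlgHom.toLinearMap_apply, smul_eq_mul]
    match l, hl with
    | [], hl => exact absurd rfl (ne_nil_of_mem_stdPaths _ hl)
    | [v], hl =>
      simp only [pathProd, he.chi_apply]
      by_cases hv : v = b
      · subst hv
        rw [hfb]
        simp
      · have h1 := hfmul (e v) (e v) (by rw [he.chi_apply, if_neg (Ne.symm hv)])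
        rw [he.mul_self, he.chi_apply] at h1
        by_cases hc : c = v
        · subst hc
          rw [hf _ (he.mem_ker_of_ne hv), hk hv]
          simp [Ne.symm hv]
        · rw [if_neg hc, zero_mul] at h1
          simp [h1, hc, Ne.symm hv]
    | c' :: b' :: l, hl =>
      have h2 : 2 ≤ (c' :: b' :: l).length := by simp
      rw [chi_pathProd h2, chi_pathProd h2]
      simp only [zero_mul, sub_zero, neg_zero]
      rw [pathProd]
      match l, hl with
      | b'' :: l, _ =>
        rw [hfmul _ _ (chi_pathProd (by simp) b), chi_arrow, zero_mul]
      | [], hl =>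
        simp only [pathProd]
        by_cases hb : b' = b
        · subst hb
          rw [he.arrow_mul]
          by_cases hc : c' = c
          · subst hc
            rw [hf _ (arrow_mem_ker b' c'), hφ hl]
          · rw [← he.mul_arrow, hfmul _ _ (chi_arrow b' b' c'), he.chi_apply,
              if_neg (Ne.symm hc), zero_mul]
        · rw [hfmul _ _ (he.mem_ker_of_ne hb), chi_arrow, zero_mul]
  refine ⟨k, fun x => ?_⟩
  have h := LinearMap.congr_fun key x.1
  simp only [LinearMap.sub_apply, LinearMap.neg_apply, LinearMap.smulRight_apply,
      AlgHom.toLinearMap_apply, smul_eq_mul, mem_ker_toCharModule.1 x.2, zero_mul, neg_zero] at h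
  rw [← hf x.1 x.2]
  exact sub_eq_zero.1 h

/-- The form is a matrix entry from `typeCut c` to a set `D` of type `b` with one cut more. No set
lies strictly between, so the entry of `x * y` has only two terms. The one with the diagonal entry
of `y` at `D` vanishes for `y` in the kernel of `chi F b`, and the other is semilinear. -/
theorem exists_semilinear (hp : p = 0 ∨ 7 ≤ p) {b c : Fin 11} (h : [c, b] ∈ stdPaths) :
    ∃ φ : LinearMap.ker (toCharModule (chi F b)) →ₗ[descentAlgebra F 6] CharModule (chi F c),
      (φ ⟨arrow e b c, arrow_mem_ker b c⟩).val ≠ 0 := by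
  obtain ⟨D, hD, h0, h6, -⟩ := pathCoeff_separates _ h
  simp only [List.headD_cons, List.length_cons, List.length_nil] at hD h0 h6
  have hne : regCoeff F (typeCut c) D (arrow e b c) ≠ 0 := by
    have h1 := he.regCoeff_pathProd (l := [c, b]) (List.cons_ne_nil _ _) (C := typeCut c) (D := D)
      (by simpa using hD)
    simp only [pathProd, he.arrow_mul] at h1
    rw [h1]
    exact intCast_ne_zero hp h0 h6
  have hDb : cutType D = b := by
    rw [he.regCoeff_arrow (by omega)] at hne
    exact (ite_ne_right_iff.1 hne).1.2
  refine ⟨CharModule.homOfLinear _ _ (regCoeff F (typeCut c) D) fun x y hy => ?_, hne⟩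
  rw [regCoeff_mul, Finset.sum_eq_single (typeCut c), regCoeff_self_eq_chi, cutType_typeCut]
  · intro E _ hE
    by_cases h1 : typeCut c ⊆ E
    · by_cases h2 : E ⊆ D
      · have h3 := card_lt_card (h1.ssubset_of_ne (Ne.symm hE))
        rw [eq_of_subset_of_card_le h2 (by omega), regCoeff_self_eq_chi, hDb,
          mem_ker_toCharModule.1 hy, mul_zero]
      · rw [regCoeff_eq_zero h2, mul_zero]
    · rw [regCoeff_eq_zero h1, zero_mul]
  · intro h
    exact absurd (mem_univ _) h

theorem extDim_vertexPartition (hp : p = 0 ∨ 7 ≤ p) (b c : Fin 11) :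
    extDim F (vertexPartition b) (vertexPartition c) = if [c, b] ∈ stdPaths then 1 else 0 := by
  rw [extDim_eq]
  split_ifs with h
  · obtain ⟨φ₀, h₀⟩ := he.exists_semilinear hp h
    exact finrank_ext_charModule_eq_one _ _ ⟨arrow e b c, arrow_mem_ker b c⟩ (chi_arrow c b c)
      (fun φ hφ => he.semilinear_eq hp φ fun _ => hφ) φ₀ h₀
  · exact finrank_ext_charModule_eq_zero _ _ fun φ => he.semilinear_eq hp φ fun h' => absurd h' h

end IsDualFamily

end ExtQuiver

/-! ### The presentation of the descent algebra by quiver and relation -/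

section Presentation

section Vertices

variable {F : Type*} {p : ℕ}

/-- The number of the partition at a vertex of the Ext quiver. -/
def vertexIndex (l : ExtQuiver F p 6) : Fin 11 :=
  (Equiv.ofBijective vertexPartition vertexPartition_bijective).symm l.1

theorem vertexPartition_vertexIndex (l : ExtQuiver F p 6) :
    vertexPartition (vertexIndex l) = l.1 :=
  (Equiv.ofBijective vertexPartition vertexPartition_bijective).apply_symm_apply l.1

theorem vertexIndex_injective :
    Function.Injective (vertexIndex : ExtQuiver F p 6 → Fin 11) := fun l m h =>
  Subtype.ext (by rw [← vertexPartition_vertexIndex, h, vertexPartition_vertexIndex])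

theorem vertexIndex_ofPartition (hp : p = 0 ∨ 7 ≤ p) (v : Fin 11) :
    vertexIndex (ExtQuiver.ofPartition F hp (vertexPartition v)) = v :=
  (Equiv.ofBijective vertexPartition vertexPartition_bijective).symm_apply_apply v

theorem eq_ofPartition (hp : p = 0 ∨ 7 ≤ p) {l : ExtQuiver F p 6} {v : Fin 11}
    (h : vertexIndex l = v) : l = ExtQuiver.ofPartition F hp (vertexPartition v) :=
  vertexIndex_injective (h.trans (vertexIndex_ofPartition hp v).symm)

end Vertices

variable {F : Type*} [Field F] {p : ℕ}

/-- The vertices of a path, listed from its target to its source. -/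
def pathVertices {a : ExtQuiver F p 6} : {b : ExtQuiver F p 6} → Quiver.Path a b → List (Fin 11)
  | _, .nil => [vertexIndex a]
  | c, .cons P _ => vertexIndex c :: pathVertices P

theorem exists_pathVertices_eq_cons {a b : ExtQuiver F p 6} (P : Quiver.Path a b) :
    ∃ l, pathVertices P = vertexIndex b :: l := by
  cases P with
  | nil => exact ⟨[], rfl⟩
  | cons P _ => exact ⟨_, rfl⟩

theorem pathVertices_ne_nil {a b : ExtQuiver F p 6} (P : Quiver.Path a b) :
    pathVertices P ≠ [] := by
  obtain ⟨l, h⟩ := exists_pathVertices_eq_cons P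
  rw [h]
  exact List.cons_ne_nil _ _

theorem headD_pathVertices {a b : ExtQuiver F p 6} (P : Quiver.Path a b) :
    (pathVertices P).headD 0 = vertexIndex b := by
  obtain ⟨l, h⟩ := exists_pathVertices_eq_cons P
  rw [h]
  rfl

theorem getLastD_pathVertices {a b : ExtQuiver F p 6} (P : Quiver.Path a b) :
    (pathVertices P).getLastD 0 = vertexIndex a := by
  induction P with
  | nil => rfl
  | cons P _ ih =>
    obtain ⟨l, h⟩ := exists_pathVertices_eq_cons P
    rw [h] at ih
    rw [pathVertices, h, ← ih]
    simp only [List.getLastD_cons]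

theorem length_pathVertices {a b : ExtQuiver F p 6} (P : Quiver.Path a b) :
    (pathVertices P).length = P.length + 1 := by
  induction P with
  | nil => rfl
  | cons P _ ih => rw [pathVertices, List.length_cons, ih, Quiver.Path.length_cons]

variable {e : Fin 11 → descentAlgebra F 6}

theorem pathProd_pathVertices_cons {a b c : ExtQuiver F p 6} (P : Quiver.Path a b) (f : b ⟶ c) :
    pathProd e (pathVertices (P.cons f)) =
      arrow e (vertexIndex b) (vertexIndex c) * pathProd e (pathVertices P) := by
  obtain ⟨l, h⟩ := exists_pathVertices_eq_cons P
  rw [pathVertices, h, pathProd]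

/-- The standard paths together with `2²1² → 321 → 51 → 6`. -/
def quiverPaths : Finset (List (Fin 11)) := insert [0, 1, 5, 8] stdPaths

theorem singleton_mem_quiverPaths : ∀ v, [v] ∈ quiverPaths := by decide +kernel

/-- The list is closed under adding an arrow at the target, so it contains the vertices of every
path; in particular the quiver has only finitely many paths. -/
theorem cons_mem_quiverPaths : ∀ l ∈ quiverPaths, ∀ c, [c, l.headD 0] ∈ stdPaths →
    c :: l ∈ quiverPaths := by
  decide +kernel

theorem isChain_of_mem_quiverPaths :
    ∀ l ∈ quiverPaths, l.IsChain fun c b => [c, b] ∈ stdPaths := by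
  decide +kernel

theorem eq_of_mem_stdPaths : ∀ l ∈ stdPaths, l.headD 0 = 0 ∧ l.getLastD 0 = 8 →
    l = [0, 2, 5, 8] := by
  decide +kernel

namespace IsDualFamily

variable [CharP F p] (he : IsDualFamily e) (hp : p = 0 ∨ 7 ≤ p)

include he hp

theorem card_hom (b c : ExtQuiver F p 6) : extDim F b.1 c.1 =
    if [vertexIndex c, vertexIndex b] ∈ stdPaths then 1 else 0 := by
  rw [← vertexPartition_vertexIndex b, ← vertexPartition_vertexIndex c,
    he.extDim_vertexPartition hp]

theorem mem_of_hom {b c : ExtQuiver F p 6} (f : b ⟶ c) :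
    [vertexIndex c, vertexIndex b] ∈ stdPaths := by
  have h : 0 < extDim F b.1 c.1 := Fin.pos f
  rw [he.card_hom hp] at h
  by_contra hc
  simp [hc] at h

theorem nonempty_hom {b c : ExtQuiver F p 6} (h : [vertexIndex c, vertexIndex b] ∈ stdPaths) :
    Nonempty (b ⟶ c) := by
  have h1 := he.card_hom hp b c
  rw [if_pos h] at h1
  exact ⟨(⟨0, by omega⟩ : Fin (extDim F b.1 c.1))⟩

theorem hom_eq {b c : ExtQuiver F p 6} (f g : b ⟶ c) : f = g := by
  have h1 := he.card_hom hp b c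
  rw [if_pos (he.mem_of_hom hp f)] at h1
  exact (Fin.subsingleton_iff_le_one.2 h1.le).elim f g

theorem pathVertices_mem {a b : ExtQuiver F p 6} (P : Quiver.Path a b) :
    pathVertices P ∈ quiverPaths := by
  induction P with
  | nil => exact singleton_mem_quiverPaths _
  | cons P f ih =>
    refine cons_mem_quiverPaths _ ih _ ?_
    rw [headD_pathVertices]
    exact he.mem_of_hom hp f

/-- There is at most one arrow from one vertex to another, so a path is determined by its vertices.
-/
theorem path_eq_of_pathVertices {a b a' b' : ExtQuiver F p 6} (P : Quiver.Path a b)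
    (Q : Quiver.Path a' b') (h : pathVertices P = pathVertices Q) :
    (⟨a, b, P⟩ : AllPaths (ExtQuiver F p 6)) = ⟨a', b', Q⟩ := by
  induction P generalizing b' with
  | nil =>
    cases Q with
    | nil =>
      have := vertexIndex_injective (List.singleton_inj.1 h)
      subst this
      rfl
    | cons Q _ => exact absurd (List.cons.inj h).2.symm (pathVertices_ne_nil Q)
  | cons P f ih =>
    cases Q with
    | nil => exact absurd (List.cons.inj h).2 (pathVertices_ne_nil P)
    | cons Q g =>
      obtain ⟨h1, h2⟩ := List.cons.inj h
      have h3 := vertexIndex_injective h1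
      subst h3
      have h4 := ih Q h2
      cases h4
      rw [he.hom_eq hp f g]

theorem exists_path {l : List (Fin 11)} (hl : l ≠ [])
    (h : l.IsChain fun c b => [c, b] ∈ stdPaths) :
    ∃ P : AllPaths (ExtQuiver F p 6), pathVertices P.2.2 = l := by
  induction l with
  | nil => exact absurd rfl hl
  | cons c l ih =>
    cases l with
    | nil =>
      refine ⟨⟨_, _, Quiver.Path.nil (a := ExtQuiver.ofPartition F hp (vertexPartition c))⟩, ?_⟩
      exact congrArg (fun v => [v]) (vertexIndex_ofPartition hp c)
    | cons b l =>
      rw [List.isChain_cons_cons] at h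
      obtain ⟨⟨x, y, P⟩, hP⟩ := ih (List.cons_ne_nil _ _) h.2
      have hy : vertexIndex y = b := by
        rw [← headD_pathVertices P, hP]
        rfl
      obtain ⟨f⟩ := he.nonempty_hom hp (b := y)
        (c := ExtQuiver.ofPartition F hp (vertexPartition c))
        (by rw [vertexIndex_ofPartition, hy]; exact h.1)
      refine ⟨⟨x, _, P.cons f⟩, ?_⟩
      change vertexIndex _ :: pathVertices P = _
      rw [hP, vertexIndex_ofPartition]

omit hp [CharP F p]

theorem pathProd_comp {a b c : ExtQuiver F p 6} (α : Quiver.Path a b) (β : Quiver.Path b c) :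
    pathProd e (pathVertices (α.comp β)) =
      pathProd e (pathVertices β) * pathProd e (pathVertices α) := by
  induction β with
  | nil =>
    have h := he.mul_pathProd (pathVertices_ne_nil α) (vertexIndex b)
    rw [if_pos (headD_pathVertices α)] at h
    exact h.symm
  | cons β f ih =>
    rw [Quiver.Path.comp_cons, pathProd_pathVertices_cons, pathProd_pathVertices_cons, ih,
      mul_assoc]

theorem pathProd_mul_of_ne {a b c d : ExtQuiver F p 6} (α : Quiver.Path a b)
    (β : Quiver.Path c d) (h : b ≠ c) :
    pathProd e (pathVertices β) * pathProd e (pathVertices α) = 0 := by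
  have h1 := he.mul_pathProd (pathVertices_ne_nil α) (vertexIndex b)
  have h2 := he.pathProd_mul (pathVertices_ne_nil β) (vertexIndex c)
  rw [if_pos (headD_pathVertices α)] at h1
  rw [if_pos (getLastD_pathVertices β)] at h2
  rw [← h1, ← h2, mul_assoc, ← mul_assoc (e _) (e _),
    he.mul_ne fun hv => h (vertexIndex_injective hv).symm, zero_mul, mul_zero]

end IsDualFamily

/-- The linear map from the path algebra sending each path to its product. -/
def pathLinearMap (e : Fin 11 → descentAlgebra F 6) :
    PathAlgebra F (ExtQuiver F p 6) →ₗ[F] descentAlgebra F 6 :=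
  (PathAlgebra.basis F (ExtQuiver F p 6)).constr F fun P => pathProd e (pathVertices P.2.2)

theorem pathLinearMap_basis (e : Fin 11 → descentAlgebra F 6)
    (P : AllPaths (ExtQuiver F p 6)) :
    pathLinearMap e (PathAlgebra.basis F _ P) = pathProd e (pathVertices P.2.2) :=
  Module.Basis.constr_basis _ _ _ _

/-! ### The homomorphism from the path algebra and its kernel. -/

namespace IsDualFamily

variable (he : IsDualFamily e)

include he

theorem pathLinearMap_mul (x y : PathAlgebra F (ExtQuiver F p 6)) :
    pathLinearMap e (x * y) = pathLinearMap e x * pathLinearMap e y := by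
  have key : (PathAlgebra.mulHom F (ExtQuiver F p 6)).compr₂ (pathLinearMap e) =
      (LinearMap.mul F (descentAlgebra F 6)).compl₁₂ (pathLinearMap e) (pathLinearMap e) := by
    refine (PathAlgebra.basis F _).ext fun β => (PathAlgebra.basis F _).ext fun α => ?_
    simp only [LinearMap.compr₂_apply, LinearMap.compl₁₂_apply, LinearMap.mul_apply']
    rw [← PathAlgebra.mul_def, pathLinearMap_basis, pathLinearMap_basis]
    obtain ⟨a, b, α⟩ := α
    obtain ⟨c, d, β⟩ := β
    by_cases h : b = c
    · subst h
      rw [PathAlgebra.basis_mul_of_eq, pathLinearMap_basis]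
      exact he.pathProd_comp α β
    · rw [PathAlgebra.basis_mul_of_ne F h, map_zero]
      exact (he.pathProd_mul_of_ne α β h).symm
  exact LinearMap.congr_fun (LinearMap.congr_fun key x) y

theorem pathLinearMap_one (hp : p = 0 ∨ 7 ≤ p) :
    pathLinearMap e (1 : PathAlgebra F (ExtQuiver F p 6)) = 1 := by
  change pathLinearMap e (∑ v, PathAlgebra.vertex F v) = 1
  rw [map_sum, ← he.complete.complete]
  refine Fintype.sum_bijective vertexIndex
    ⟨vertexIndex_injective, fun v => ⟨_, vertexIndex_ofPartition hp v⟩⟩ _ _ fun v => ?_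
  exact pathLinearMap_basis e _

/-- The algebra homomorphism from the path algebra to the descent algebra. -/
def pathAlgHom (hp : p = 0 ∨ 7 ≤ p) :
    PathAlgebra F (ExtQuiver F p 6) →ₐ[F] descentAlgebra F 6 :=
  AlgHom.ofLinearMap (pathLinearMap e) (he.pathLinearMap_one hp) he.pathLinearMap_mul

theorem pathAlgHom_basis (hp : p = 0 ∨ 7 ≤ p) (P : AllPaths (ExtQuiver F p 6)) :
    he.pathAlgHom hp (PathAlgebra.basis F _ P) = pathProd e (pathVertices P.2.2) :=
  pathLinearMap_basis e P

variable [CharP F p]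

theorem pathAlgHom_surjective (hp : p = 0 ∨ 7 ≤ p) :
    Function.Surjective (he.pathAlgHom hp) := by
  change Function.Surjective (he.pathAlgHom hp).toLinearMap
  rw [← LinearMap.range_eq_top, eq_top_iff, ← (he.basis hp).span_eq, Submodule.span_le]
  rintro _ ⟨l, rfl⟩
  obtain ⟨P, hP⟩ := he.exists_path hp (ne_nil_of_mem_stdPaths l.1 l.2)
    (isChain_of_mem_quiverPaths l.1 (mem_insert_of_mem l.2))
  exact ⟨PathAlgebra.basis F _ P, by
    rw [AlgHom.toLinearMap_apply, pathAlgHom_basis, hP, basis_apply]⟩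

/-- Expand the left-hand product in the basis and multiply by the idempotents at its ends. The only
standard path from `2²1²` to `6` is the one through `42`, so one term survives. -/
theorem exists_relation (hp : p = 0 ∨ 7 ≤ p) :
    ∃ k : F, pathProd e [0, 1, 5, 8] = k • pathProd e [0, 2, 5, 8] := by
  have hmem : [0, 2, 5, 8] ∈ stdPaths := by decide +kernel
  have h1 := he.mul_pathProd_mul (l := [0, 1, 5, 8]) (List.cons_ne_nil _ _) 0 8
  rw [if_pos ⟨rfl, rfl⟩] at h1
  refine ⟨(he.basis hp).repr (pathProd e [0, 1, 5, 8]) ⟨_, hmem⟩, ?_⟩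
  conv_lhs => rw [← h1, ← (he.basis hp).sum_repr (pathProd e [0, 1, 5, 8])]
  simp only [Finset.mul_sum, Finset.sum_mul, mul_smul_comm, smul_mul_assoc, basis_apply]
  rw [Finset.sum_eq_single ⟨_, hmem⟩]
  · rw [he.mul_pathProd_mul (List.cons_ne_nil _ _), if_pos ⟨rfl, rfl⟩]
  · rintro ⟨l, hl⟩ _ hne
    rw [he.mul_pathProd_mul (ne_nil_of_mem_stdPaths l hl), if_neg, smul_zero]
    exact fun h => hne (Subtype.ext (eq_of_mem_stdPaths l hl h))
  · intro h
    exact absurd (mem_univ _) h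

/-- All paths other than `P₀` correspond injectively to standard lists, so their products are
independent. The kernel therefore meets their span only in zero. -/
theorem eq_zero_of_pathAlgHom_eq_zero (hp : p = 0 ∨ 7 ≤ p) {P₀ : AllPaths (ExtQuiver F p 6)}
    (hP₀ : pathVertices P₀.2.2 = [0, 1, 5, 8]) {x : PathAlgebra F (ExtQuiver F p 6)}
    (hx : he.pathAlgHom hp x = 0) (hx₀ : (PathAlgebra.basis F _).repr x P₀ = 0) : x = 0 := by
  have hmem : ∀ P : ({P₀}ᶜ : Set (AllPaths (ExtQuiver F p 6))), pathVertices P.1.2.2 ∈ stdPaths := fun P =>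
    (mem_insert.1 (he.pathVertices_mem hp P.1.2.2)).resolve_left fun h =>
      P.2 (he.path_eq_of_pathVertices hp _ _ (h.trans hP₀.symm))
  have hinj : Function.Injective fun P : ({P₀}ᶜ : Set (AllPaths (ExtQuiver F p 6))) =>
      (⟨_, hmem P⟩ : stdPaths) := fun P Q h =>
    Subtype.ext (he.path_eq_of_pathVertices hp _ _ (congrArg Subtype.val h))
  have hli : LinearIndepOn F (fun P : AllPaths (ExtQuiver F p 6) =>
      pathProd e (pathVertices P.2.2)) {P₀}ᶜ :=
    LinearIndependent.comp (he.linearIndependent hp) (fun P => ⟨_, hmem P⟩) hinj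
  rw [linearIndepOn_iff] at hli
  have h := hli ((PathAlgebra.basis F _).repr x) (by
    rw [Finsupp.mem_supported]
    intro P hP hPP
    rw [Finset.mem_coe, Finsupp.mem_support_iff] at hP
    exact hP (hPP ▸ hx₀)) (by
    rw [← hx]
    exact ((PathAlgebra.basis F (ExtQuiver F p 6)).constr_apply F _ x).symm)
  exact (LinearEquiv.map_eq_zero_iff _).1 h

end IsDualFamily

end Presentation

end DescentAlg

end

/-! ### The isomorphism with the path algebra modulo one relation. -/

theorem corollary2p8 {F : Type*} [Field F] (p : ℕ) [CharP F p] (hp : p = 0 ∨ 7 ≤ p) :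
    ∃ (I : Ideal (DescentAlg.PathAlgebra F (DescentAlg.ExtQuiver F p 6))) (_ : I.IsTwoSided)
      (ω : DescentAlg.PathAlgebra F (DescentAlg.ExtQuiver F p 6)),
      -- `I` is one-dimensional, spanned by `ω`
      ω ≠ 0 ∧ I.restrictScalars F = Submodule.span F {ω} ∧
      -- `ω` is a relation from the vertex `2²1²` to the vertex `6`
      ω ∈ DescentAlg.PathAlgebra.longPaths F (DescentAlg.ExtQuiver F p 6) 2 ∧
      ω = DescentAlg.PathAlgebra.vertex F
            (DescentAlg.ExtQuiver.ofPartition F hp DescentAlg.partition6) * ω *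
          DescentAlg.PathAlgebra.vertex F
            (DescentAlg.ExtQuiver.ofPartition F hp DescentAlg.partition2211) ∧
      -- the quotient is isomorphic to the descent algebra, and under the isomorphism the
      -- idempotent at the vertex `l` corresponds to the simple module labelled by `l`
      ∃ Φ : (DescentAlg.PathAlgebra F (DescentAlg.ExtQuiver F p 6) ⧸ I) ≃ₐ[F]
          DescentAlg.descentAlgebra F 6,
        ∀ l : DescentAlg.ExtQuiver F p 6,
          DescentAlg.simpleCharacter F l.1
            (Φ (Ideal.Quotient.mk I (DescentAlg.PathAlgebra.vertex F l))) = 1 ∧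
          ∀ m : DescentAlg.ExtQuiver F p 6, m ≠ l →
            DescentAlg.simpleCharacter F m.1
              (Φ (Ideal.Quotient.mk I (DescentAlg.PathAlgebra.vertex F l))) = 0 := by
  open DescentAlg in
  obtain ⟨e, he₁, he₂⟩ := exists_idempotents (F := F) hp
  have he : IsDualFamily e := ⟨he₁, he₂⟩
  let Ψ := he.pathAlgHom hp
  let B := PathAlgebra.basis F (ExtQuiver F p 6)
  have hmem₁ : [0, 1, 5, 8] ∈ quiverPaths := by decide +kernel
  have hmem₂ : [0, 2, 5, 8] ∈ quiverPaths := by decide +kernel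
  obtain ⟨P, hP⟩ := he.exists_path hp (List.cons_ne_nil _ _) (isChain_of_mem_quiverPaths _ hmem₁)
  obtain ⟨Q, hQ⟩ := he.exists_path hp (List.cons_ne_nil _ _) (isChain_of_mem_quiverPaths _ hmem₂)
  obtain ⟨k, hk⟩ := he.exists_relation hp
  have hPQ : Q ≠ P := by
    rintro rfl
    rw [hP] at hQ
    exact absurd hQ (by decide)
  -- The coefficient of `P` is 1, so `ω` is nonzero whatever the value of `k`.
  let ω := B P - k • B Q
  have hωP : B.repr ω P = 1 := by simp [ω, hPQ]
  have hΨω : Ψ ω = 0 := by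
    simp only [ω, map_sub, map_smul]
    rw [he.pathAlgHom_basis, he.pathAlgHom_basis, hP, hQ, hk, sub_self]
  -- The numbers 0 and 8 label the two ends because `vertexPartition 0` and `vertexPartition 8`
  -- unfold to `partition6` and `partition2211`.
  have htarget : ∀ R : AllPaths (ExtQuiver F p 6), (pathVertices R.2.2).headD 0 = 0 →
      R.2.1 = ExtQuiver.ofPartition F hp partition6 := fun R hR =>
    eq_ofPartition hp ((headD_pathVertices R.2.2).symm.trans hR)
  have hsource : ∀ R : AllPaths (ExtQuiver F p 6), (pathVertices R.2.2).getLastD 0 = 8 →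
      R.1 = ExtQuiver.ofPartition F hp partition2211 := fun R hR =>
    eq_ofPartition hp ((getLastD_pathVertices R.2.2).symm.trans hR)
  have hcorner : ∀ R : AllPaths (ExtQuiver F p 6), (pathVertices R.2.2).headD 0 = 0 →
      (pathVertices R.2.2).getLastD 0 = 8 →
      PathAlgebra.vertex F (ExtQuiver.ofPartition F hp partition6) * B R *
        PathAlgebra.vertex F (ExtQuiver.ofPartition F hp partition2211) = B R := by
    intro R h1 h2
    rw [PathAlgebra.vertex_mul_basis, if_pos (htarget R h1), PathAlgebra.basis_mul_vertex,
      if_pos (hsource R h2).symm]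
  have hlong : ∀ R : AllPaths (ExtQuiver F p 6), (pathVertices R.2.2).length = 4 →
      B R ∈ PathAlgebra.longPaths F (ExtQuiver F p 6) 2 := by
    intro R h
    rw [length_pathVertices] at h
    exact Submodule.subset_span ⟨R, by omega, rfl⟩
  have hvertex : ∀ l m : ExtQuiver F p 6, simpleCharacter F m.1 (Ψ (PathAlgebra.vertex F l)) =
      if vertexIndex m = vertexIndex l then 1 else 0 := by
    intro l m
    rw [← he.chi_apply, chi, vertexPartition_vertexIndex]
    exact congrArg _ (he.pathAlgHom_basis hp _)
  refine ⟨RingHom.ker Ψ, inferInstance, ω, ?_, ?_, ?_, ?_,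
    Ideal.quotientKerAlgEquivOfSurjective (he.pathAlgHom_surjective hp), fun l => ⟨?_, ?_⟩⟩
  · intro h
    rw [h, map_zero] at hωP
    exact zero_ne_one hωP
  · ext x
    rw [Submodule.restrictScalars_mem, RingHom.mem_ker, Submodule.mem_span_singleton]
    constructor
    · intro hx
      -- Subtracting this multiple of `ω` leaves an element of the kernel without the path `P`,
      -- which must be zero.
      refine ⟨B.repr x P, (sub_eq_zero.1 (he.eq_zero_of_pathAlgHom_eq_zero hp hP ?_ ?_)).symm⟩
      · change Ψ _ = 0
        rw [map_sub, map_smul, hΨω, smul_zero, sub_zero]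
        exact hx
      · change B.repr _ P = 0
        rw [map_sub, map_smul, Finsupp.sub_apply, Finsupp.smul_apply, hωP]
        simp
    · rintro ⟨a, rfl⟩
      rw [map_smul, hΨω, smul_zero]
  · exact Submodule.sub_mem _ (hlong P (by rw [hP]; rfl))
      (Submodule.smul_mem _ _ (hlong Q (by rw [hQ]; rfl)))
  · simp only [ω, mul_sub, sub_mul, mul_smul_comm, smul_mul_assoc]
    rw [hcorner P (by rw [hP]; rfl) (by rw [hP]; rfl),
      hcorner Q (by rw [hQ]; rfl) (by rw [hQ]; rfl)]
  · exact (hvertex l l).trans (if_pos rfl)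
  · intro m hm
    exact (hvertex l m).trans (if_neg fun h => hm (vertexIndex_injective h))
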